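/- **Theorem 5.2.** *Setting.* Let $J_i=(\ell_i,r_i)\subseteq(0,1)$, $i=1,2,3,\dots$, be pairwise disjoint non-empty open intervals with $\ell_1>\ell_2>\cdots$, let $S=\bigcup_i J_i$, $s_0=\inf S$, $s_1=\sup S$, and let $G$ be a function that is $\mathcal C^1$ on $S$. Assume: 1. $G(J_i)=(s_0,s_1)$ for every $i$; 2. $|G'|>1$ on $S$, and there are $\tau>1$, $\sigma>1$ and an integer $\kappa\ge 1$ such that for all $i$ $$\Bigl(\inf_{x\in J_i}|G'(x)|\Bigr)^{-1}<\ell_i\,\sigma\qquad\text{and}\qquad \Bigl(\inf_{x}|(G^{\kappa})'(x)|\Bigr)^{-1}<\ell_i\,\tau^{-1},$$ where the second infimum is over all $x\in J_i$ at which $G^\kappa$ is defined, that is, $x,G(x),\dots,G^{\kappa-1}(x)\in S$; 3. $G$ is decreasing on $J_1$; 4. writing $G_i^{-1}:(s_0,s_1)\to J_i$ for the inverse of $G|_{J_i}$ and $\varphi$ for the unique fixed point of $G|_{J_1}$, there is $D>0$ such that for all $N\ge 1$ $$\frac{r_{N+1}}{\ell_{N+1}}\cdot\frac{r_N-\ell_{N+1}}{G_N^{-1}(\varphi)-G_{N+1}^{-1}(\varphi)}<D;$$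 5. $\dfrac{r_i}{\ell_{i+1}}-1\to 0$ as $i\to\infty$. Let $\Lambda$ be the set of all $x$ with $G^{j}(x)\in S$ for all $j\ge 0$. Let $u:(s_0,s_1)\to(0,\infty)$ be a $\mathcal C^1$ function with $\lim_{x\to s_0^+}u(x)=\infty$ for which there is $C>0$ with $u'(x)<\dfrac{C}{(x-s_0)^2}$ for all $x\in(s_0,s_1)$. Let $\nu>0$ be real and $s(i)\in\{-1,1\}$ for $i\ge 1$. For $x\in\Lambda$ put $\eta_0(x)=1$, $\eta_j(x)=G^{j-1}(x)$ for $j\ge1$, and $$\Phi(x)=\sum_{i=1}^{\infty}s(i)\,\bigl(\eta_0(x)\cdots\eta_{i-1}(x)\bigr)^{\nu}\,u(\eta_i(x))$$ wherever the partial sums of this series converge in $\mathbb R$. An *oracle* for $x\in\mathbb R$ is a sequence $\phi$ of dyadic rationals with $|\phi(n)-x|<2^{-n}$ for all $n\in\mathbb N$. The function $\Phi$ is *computable at* $x$ if there is an oracle Turing machine $M$ such that for every oracle $\phi$ for $x$ and every $n\in\mathbb N$, the machine $M$, run with oracle $\phi$ on input $n$, halts and outputs a dyadic rational $d$ with $|\Phi(x)-d|<2^{-n}$.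 *Claim.* For all such $G$, $u$, $\nu$ and $s$ there is a point $x\in\Lambda$ at which the series defining $\Phi(x)$ converges to a real number and at which $\Phi$ is not computable. -/

import Mathlib

open Set Filter Topology

/-! ### Oracle programs and computable real functions -/

/-- Programs of oracle machines, presented as the programs for partial recursive functions
(zero, successor, the two projections of the pairing of `ℕ`, pairing, composition,
primitive recursion, unbounded search) with one additional instruction, which queries the oracle. -/
inductive OracleProgram : Type
  | zero : OracleProgram
  | succ : OracleProgram
  | left : OracleProgram
  | right : OracleProgram
  | query : OracleProgram
  | pair : OracleProgram → OracleProgram → OracleProgram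
  | comp : OracleProgram → OracleProgram → OracleProgram
  | prec : OracleProgram → OracleProgram → OracleProgram
  | rfind : OracleProgram → OracleProgram

/-- The partial function computed by an oracle program when it is run with the oracle `φ`.
The program itself does not depend on the oracle. The value is undefined where the program
does not halt. -/
def OracleProgram.run (φ : ℕ → ℕ) : OracleProgram → ℕ →. ℕ
  | .zero => fun _ => Part.some 0
  | .succ => fun n => Part.some (n + 1)
  | .left => fun n => Part.some (Nat.unpair n).1
  | .right => fun n => Part.some (Nat.unpair n).2
  | .query => fun n => Part.some (φ n)
  | .pair a b => fun n => Nat.pair <$> a.run φ n <*> b.run φ n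
  | .comp a b => fun n => b.run φ n >>= a.run φ
  | .prec a b => fun n =>
      (Nat.unpair n).2.rec (a.run φ (Nat.unpair n).1) fun y ih => do
        let i ← ih
        b.run φ (Nat.pair (Nat.unpair n).1 (Nat.pair y i))
  | .rfind a => fun n =>
      Nat.rfind fun k => (fun m => decide (m = 0)) <$> a.run φ (Nat.pair n k)

/-- Oracle programs compute exactly the functions that are recursive in the oracle, in the sense
of Mathlib. -/
theorem OracleProgram.exists_run_eq_iff (φ : ℕ → ℕ) (f : ℕ →. ℕ) :
    (∃ M : OracleProgram, M.run φ = f) ↔ Nat.RecursiveIn {(φ : ℕ →. ℕ)} f := by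
  constructor
  · rintro ⟨M, rfl⟩
    induction M with
    | zero => exact Nat.RecursiveIn.zero
    | succ => exact Nat.RecursiveIn.succ
    | left => exact Nat.RecursiveIn.left
    | right => exact Nat.RecursiveIn.right
    | query => exact Nat.RecursiveIn.oracle _ rfl
    | pair a b ha hb => exact Nat.RecursiveIn.pair ha hb
    | comp a b ha hb => exact Nat.RecursiveIn.comp ha hb
    | prec a b ha hb => exact Nat.RecursiveIn.prec ha hb
    | rfind a ha => exact Nat.RecursiveIn.rfind ha
  · intro h
    induction h with
    | zero => exact ⟨.zero, rfl⟩
    | succ => exact ⟨.succ, rfl⟩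
    | left => exact ⟨.left, rfl⟩
    | right => exact ⟨.right, rfl⟩
    | oracle g hg => exact ⟨.query, (Set.mem_singleton_iff.1 hg).symm⟩
    | pair _ _ ha hb =>
      obtain ⟨a, rfl⟩ := ha
      obtain ⟨b, rfl⟩ := hb
      exact ⟨.pair a b, rfl⟩
    | comp _ _ ha hb =>
      obtain ⟨a, rfl⟩ := ha
      obtain ⟨b, rfl⟩ := hb
      exact ⟨.comp a b, rfl⟩
    | prec _ _ ha hb =>
      obtain ⟨a, rfl⟩ := ha
      obtain ⟨b, rfl⟩ := hb
      exact ⟨.prec a b, rfl⟩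
    | rfind _ ha =>
      obtain ⟨a, rfl⟩ := ha
      exact ⟨.rfind a, rfl⟩

/-- The dyadic rational `p * 2 ^ q` (with `p q : ℤ`) that a natural number encodes:
the two components of its unpairing are read as codes of the integers `p` and `q`. -/
noncomputable def dyadic (c : ℕ) : ℝ :=
  (Equiv.intEquivNat.symm (Nat.unpair c).1 : ℝ) *
    (2 : ℝ) ^ (Equiv.intEquivNat.symm (Nat.unpair c).2)

/-- The numbers with a code are exactly the dyadic rationals. -/
theorem range_dyadic : Set.range dyadic = {x : ℝ | ∃ p q : ℤ, x = p * (2 : ℝ) ^ q} := by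
  ext x
  constructor
  · rintro ⟨c, rfl⟩
    exact ⟨_, _, rfl⟩
  · rintro ⟨p, q, rfl⟩
    exact ⟨Nat.pair (Equiv.intEquivNat p) (Equiv.intEquivNat q), by simp [dyadic]⟩

/-- `φ`, a sequence of (codes of) dyadic rationals, is an oracle for the real number `x`. -/
def IsOracleFor (φ : ℕ → ℕ) (x : ℝ) : Prop :=
  ∀ n : ℕ, |dyadic (φ n) - x| < (2 : ℝ) ^ (-(n : ℤ))

/-- `f` is (uniformly) computable on `A`: a single oracle program, run on input `n` with any oracle
for any `x ∈ A`, halts and outputs a dyadic rational at distance less than `2 ^ (-n)` from `f x`. -/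
def IsComputableOn (f : ℝ → ℝ) (A : Set ℝ) : Prop :=
  ∃ M : OracleProgram, ∀ x ∈ A, ∀ φ : ℕ → ℕ, IsOracleFor φ x →
    ∀ n : ℕ, ∃ d ∈ M.run φ n, |f x - dyadic d| < (2 : ℝ) ^ (-(n : ℤ))

/-- `f` is computable at the point `x`. -/
def IsComputableAt (f : ℝ → ℝ) (x : ℝ) : Prop :=
  IsComputableOn f {x}

/-! ### The expanding maps

Throughout, sequences that are indexed by the positive integers on paper are indexed by `ℕ`, so
that the intervals are `J 0, J 1, …` with `J i = (ℓ i, r i)`. The map `G` is a total function in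
Lean, but only its values on the union of these intervals are used. -/

/-- The union `S` of the intervals `J i = (ℓ i, r i)`, the domain of `G`. -/
def branchDomain (ℓ r : ℕ → ℝ) : Set ℝ :=
  ⋃ i, Ioo (ℓ i) (r i)

/-- The left end `s₀ = inf S`. -/
noncomputable def leftEnd (ℓ r : ℕ → ℝ) : ℝ := sInf (branchDomain ℓ r)

/-- The right end `s₁ = sup S`. -/
noncomputable def rightEnd (ℓ r : ℕ → ℝ) : ℝ := sSup (branchDomain ℓ r)

/-- The points at which the iterate `G ^ n` of the partial map `G : S → (s₀, s₁)` is defined. -/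
def iterateDomain (G : ℝ → ℝ) (ℓ r : ℕ → ℝ) (n : ℕ) : Set ℝ :=
  {x | ∀ j < n, G^[j] x ∈ branchDomain ℓ r}

/-- The invariant set `Λ`: the points all of whose iterates under `G : S → (s₀, s₁)` are defined. -/
def invariantSet (G : ℝ → ℝ) (ℓ r : ℕ → ℝ) : Set ℝ :=
  {x | ∀ j : ℕ, G^[j] x ∈ branchDomain ℓ r}

/-- The infimum of `|(G ^ n)'|` over the points of `J i` at which `G ^ n` is defined. -/
noncomputable def infAbsDeriv (G : ℝ → ℝ) (ℓ r : ℕ → ℝ) (n i : ℕ) : ℝ :=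
  sInf ((fun x => |deriv (G^[n]) x|) '' (Ioo (ℓ i) (r i) ∩ iterateDomain G ℓ r n))

/-- The inverse branch `(s₀, s₁) → J i` of `G`. -/
noncomputable def inverseBranch (G : ℝ → ℝ) (ℓ r : ℕ → ℝ) (i : ℕ) : ℝ → ℝ :=
  Function.invFunOn G (Ioo (ℓ i) (r i))

/-- The standing assumptions on `G`: it is continuously differentiable on a disjoint union of open
intervals `J i = (ℓ i, r i) ⊆ (0, 1)` with decreasing left ends, and satisfies the conditions
below. -/
structure IsExpandingBranchedMap (G : ℝ → ℝ) (ℓ r : ℕ → ℝ) : Prop where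
  left_lt_right : ∀ i, ℓ i < r i
  subset_unit : ∀ i, Ioo (ℓ i) (r i) ⊆ Ioo 0 1
  left_strictAnti : StrictAnti ℓ
  disjoint : Pairwise fun i j => Disjoint (Ioo (ℓ i) (r i)) (Ioo (ℓ j) (r j))
  contDiffOn : ContDiffOn ℝ 1 G (branchDomain ℓ r)
  /-- Every branch is onto `(s₀, s₁)`. -/
  image_branch : ∀ i, G '' Ioo (ℓ i) (r i) = Ioo (leftEnd ℓ r) (rightEnd ℓ r)
  /-- `|G'| > 1`. -/
  one_lt_abs_deriv : ∀ x ∈ branchDomain ℓ r, 1 < |deriv G x|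
  /-- Uniform expansion of some iterate, relative to the position of the interval. -/
  expansion : ∃ τ > (1 : ℝ), ∃ σ > (1 : ℝ), ∃ κ ≥ (1 : ℕ), ∀ i,
    (infAbsDeriv G ℓ r 1 i)⁻¹ < ℓ i * σ ∧ (infAbsDeriv G ℓ r κ i)⁻¹ < ℓ i * τ⁻¹
  /-- The first (rightmost) branch is decreasing. -/
  first_decreasing : StrictAntiOn G (Ioo (ℓ 0) (r 0))
  /-- With `p` the fixed point of the first branch, the distance between the preimages of `p` under
  two consecutive branches is comparable with the length of the interval spanned by the two. -/
  gap : ∃ D > (0 : ℝ), ∀ p ∈ Ioo (ℓ 0) (r 0), G p = p → ∀ N : ℕ,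
    r (N + 1) / ℓ (N + 1) *
      ((r N - ℓ (N + 1)) / (inverseBranch G ℓ r N p - inverseBranch G ℓ r (N + 1) p)) < D
  /-- Consecutive intervals are asymptotically negligible relative to their position. -/
  ratio_tendsto : Tendsto (fun i => r i / ℓ (i + 1) - 1) atTop (𝓝 0)

/-! ### The weights and the generalized Brjuno functions -/

/-- The assumptions on the weight `u : (s₀, s₁) → (0, ∞)`; only its values on `(s₀, s₁)` are
used. -/
structure IsBrjunoWeight (u : ℝ → ℝ) (s₀ s₁ : ℝ) : Prop where
  contDiffOn : ContDiffOn ℝ 1 u (Ioo s₀ s₁)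
  pos : ∀ x ∈ Ioo s₀ s₁, 0 < u x
  tendsto_atTop : Tendsto u (𝓝[>] s₀) atTop
  deriv_lt : ∃ C > (0 : ℝ), ∀ x ∈ Ioo s₀ s₁, deriv u x < C / (x - s₀) ^ 2

/-- The `n`-th partial sum of the series `Φ(x) = ∑ᵢ s(i) (η₁(x) ⋯ ηᵢ₋₁(x))^ν u(ηᵢ(x))`, `i ≥ 1`,
where `ηᵢ = G ^ (i - 1)`. In the code `i = k + 1`, and `s k` is the sign of the `k`-th term. -/
noncomputable def brjunoPartialSum (G u : ℝ → ℝ) (ν : ℝ) (s : ℕ → ℝ) (x : ℝ) (n : ℕ) : ℝ :=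
  ∑ k ∈ Finset.range n, s k * (∏ j ∈ Finset.range k, G^[j] x) ^ ν * u (G^[k] x)

/-- The generalized Brjuno function `Φ`, the sum of the series; meaningful at the points where the
partial sums converge. -/
noncomputable def generalizedBrjuno (G u : ℝ → ℝ) (ν : ℝ) (s : ℕ → ℝ) (x : ℝ) : ℝ :=
  limUnder atTop (brjunoPartialSum G u ν s x)

/-!
If `Φ` were computable at each point of `Λ` where the series converges, then these points would be
covered by countably many sets `A M`, one for each program `M`, and `Φ` would be continuous on
each of them: a halting computation uses finitely many values of its oracle
(`OracleProgram.eventually_mem_run`), and these values also fit an oracle for any nearby point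
(`IsOracleFor.eventually_exists`). A Baire category argument excludes this.

The complete metric space for it is the closure, in `ℝ × ℓ¹`, of the set of pairs of a point `x` and
the sequence of the terms of `Φ(x)`, where `x = h(p)` runs over the preimages, under compositions
`h` of inverse branches, of the fixed point `p` of the first branch (`termGraph`). The pairs with
`x ∈ Λ` form a residual set, and for them the series at `x` still has the second component as its
sequence of terms, so it converges absolutely.

That `A M` is nowhere dense there follows from `IsInverseIterate.exists_perturbation`: near every
`x = h(p)` there are points `y = h(g₀^m(g_N(p)))` whose terms are within `δ` of those of `x` in `ℓ¹`
and whose sum differs by at least `c δ`, with `c` independent of `x` and `δ`. The large digit `N`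
makes `u(g_N(p))` large. The term in which it occurs carries the weight of a product of `m` factors
`g₀^j(g_N(p))`, each of them at least `ℓ 0`, so as `m` grows the term decreases to `0` by bounded
ratios, and some `m` brings it to size about `δ / 2` (`exists_digitWeight_mem`). As `N → ∞` this
`m` tends to infinity; hence `y → x`, and all other terms converge in `ℓ¹` to those of `x` by
dominated convergence (`IsInverseIterate.exists_dominating`). The majorant is geometric, because
two consecutive visits to the decreasing first branch keep a point away from `1`, and because the
bound on `u'` makes `u` bounded on each branch.
-/

/-! ### Oracle computations use finitely many answers -/

instance : Countable OracleProgram := by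
  let enc : OracleProgram → ℕ := fun M =>
    OracleProgram.rec (motive := fun _ => ℕ) (Nat.pair 0 0) (Nat.pair 1 0) (Nat.pair 2 0)
      (Nat.pair 3 0) (Nat.pair 4 0) (fun _ _ a b => Nat.pair 5 (Nat.pair a b))
      (fun _ _ a b => Nat.pair 6 (Nat.pair a b)) (fun _ _ a b => Nat.pair 7 (Nat.pair a b))
      (fun _ a => Nat.pair 8 a) M
  refine (show Function.Injective enc from fun M => ?_).countable
  induction M with
  | zero | succ | left | right | query => intro M' h; cases M' <;> simp [enc] at h ⊢
  | pair a b ha hb | comp a b ha hb | prec a b ha hb =>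
    intro M' h
    cases M' <;> simp [enc] at h ⊢
    exact ⟨ha h.1, hb h.2⟩
  | rfind a ha =>
    intro M' h
    cases M' <;> simp [enc] at h ⊢
    exact ha h

/-- The use principle: a halting computation consults the oracle at finitely many places, so its
result is locally constant in the oracle, for the product topology on `ℕ → ℕ`. -/
theorem OracleProgram.eventually_mem_run (M : OracleProgram) {φ : ℕ → ℕ} {n d : ℕ}
    (h : d ∈ M.run φ n) : ∀ᶠ ψ in 𝓝 φ, d ∈ M.run ψ n := by
  induction M generalizing n d with
  | zero | succ | left | right => exact Eventually.of_forall fun ψ => h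
  | query =>
    simp only [run, Part.mem_some_iff] at h ⊢
    have : Tendsto (fun ψ : ℕ → ℕ => ψ n) (𝓝 φ) (𝓝 (φ n)) := (continuous_apply n).tendsto φ
    rw [nhds_discrete ℕ, tendsto_pure] at this
    exact this.mono fun ψ hψ => h.trans hψ.symm
  | pair a b ha hb =>
    simp only [run, Seq.seq, Part.map_eq_map, Part.mem_bind_iff, Part.mem_map_iff] at h ⊢
    obtain ⟨f, ⟨x, hx, rfl⟩, y, hy, rfl⟩ := h
    filter_upwards [ha hx, hb hy] with ψ h1 h2
    exact ⟨_, ⟨x, h1, rfl⟩, y, h2, rfl⟩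
  | comp a b ha hb =>
    obtain ⟨x, hx, hy⟩ := Part.mem_bind_iff.1 h
    filter_upwards [hb hx, ha hy] with ψ h1 h2
    exact Part.mem_bind_iff.2 ⟨x, h1, h2⟩
  | prec a b ha hb =>
    simp only [run, Part.bind_eq_bind] at h ⊢
    generalize (Nat.unpair n).2 = k at h ⊢
    induction k generalizing d with
    | zero => exact ha h
    | succ k ih =>
      simp only [Part.mem_bind_iff] at h ⊢
      obtain ⟨x, hx, hy⟩ := h
      filter_upwards [ih hx, hb hy] with ψ h1 h2
      exact ⟨x, h1, h2⟩
  | rfind a ha =>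
    obtain ⟨h1, h2⟩ := Nat.mem_rfind.1 h
    obtain ⟨x, hx, hx0⟩ := (Part.mem_map_iff _).1 h1
    have h3 : ∀ m ∈ Finset.range d, ∀ᶠ ψ in 𝓝 φ, ∃ y ∈ a.run ψ (Nat.pair n m),
        decide (y = 0) = false := by
      intro m hm
      obtain ⟨y, hy, hy0⟩ := (Part.mem_map_iff _).1 (h2 (Finset.mem_range.1 hm))
      exact (ha hy).mono fun ψ h => ⟨y, h, hy0⟩
    filter_upwards [ha hx, (Finset.eventually_all _).2 h3] with ψ h4 h5
    exact Nat.mem_rfind.2 ⟨(Part.mem_map_iff _).2 ⟨x, h4, hx0⟩,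
      fun {m} hm => (Part.mem_map_iff _).2 (h5 m (Finset.mem_range.2 hm))⟩

theorem exists_isOracleFor (x : ℝ) : ∃ φ, IsOracleFor φ x := by
  have : ∀ n : ℕ, ∃ c : ℕ, |dyadic c - x| < (2 : ℝ) ^ (-(n : ℤ)) := by
    intro n
    have hmem : (⌊x * 2 ^ n⌋ : ℝ) * (2 : ℝ) ^ (-(n : ℤ)) ∈ range dyadic := by
      rw [range_dyadic]; exact ⟨_, _, rfl⟩
    obtain ⟨c, hc⟩ := hmem
    refine ⟨c, ?_⟩
    have h1 := Int.floor_le (x * 2 ^ n)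
    have h2 := Int.lt_floor_add_one (x * 2 ^ n)
    have h3 : x = (x * 2 ^ n) * (2 : ℝ) ^ (-(n : ℤ)) := by
      rw [zpow_neg, zpow_natCast, mul_assoc, mul_inv_cancel₀ (by positivity), mul_one]
    have h4 : (0 : ℝ) < (2 : ℝ) ^ (-(n : ℤ)) := by positivity
    rw [hc, abs_lt]
    constructor <;> nlinarith
  choose φ hφ using this
  exact ⟨φ, hφ⟩

/-- Every neighbourhood of an oracle for `x` contains oracles for all points close to `x`. -/
theorem IsOracleFor.eventually_exists {φ : ℕ → ℕ} {x : ℝ} (h : IsOracleFor φ x)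
    {s : Set (ℕ → ℕ)} (hs : s ∈ 𝓝 φ) : ∀ᶠ y in 𝓝 x, ∃ ψ ∈ s, IsOracleFor ψ y := by
  rw [nhds_pi, Filter.mem_pi] at hs
  obtain ⟨F, hF, t, ht, hts⟩ := hs
  have h1 : ∀ i ∈ F, ∀ᶠ y in 𝓝 x, |dyadic (φ i) - y| < (2 : ℝ) ^ (-(i : ℤ)) := fun i _ =>
    (Continuous.tendsto (by fun_prop : Continuous fun y => |dyadic (φ i) - y|) x).eventually_lt_const
      (h i)
  filter_upwards [(eventually_all_finite hF).2 h1] with y hy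
  obtain ⟨χ, hχ⟩ := exists_isOracleFor y
  classical
  refine ⟨fun i => if i ∈ F then φ i else χ i, hts fun i hi => ?_, fun i => ?_⟩
  · simpa [hi] using mem_of_mem_nhds (ht i)
  · by_cases hi : i ∈ F
    · simpa [hi] using hy i hi
    · simpa [hi] using hχ i

/-- On the set of points where a program computes `f`, the function `f` is continuous. -/
theorem eventually_abs_sub_lt_of_computes {M : OracleProgram} {f : ℝ → ℝ} {A : Set ℝ}
    (hM : ∀ x ∈ A, ∀ φ : ℕ → ℕ, IsOracleFor φ x →
      ∀ n : ℕ, ∃ d ∈ M.run φ n, |f x - dyadic d| < (2 : ℝ) ^ (-(n : ℤ)))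
    {x ε : ℝ} (hx : x ∈ A) (hε : 0 < ε) : ∀ᶠ y in 𝓝 x, y ∈ A → |f y - f x| < ε := by
  obtain ⟨n, hn⟩ := exists_pow_lt_of_lt_one (half_pos hε) (by norm_num : (1 / 2 : ℝ) < 1)
  have hn' : (2 : ℝ) ^ (-(n : ℤ)) < ε / 2 := by simpa using hn
  obtain ⟨φ, hφ⟩ := exists_isOracleFor x
  obtain ⟨d, hd, hxd⟩ := hM x hx φ hφ n
  filter_upwards [hφ.eventually_exists (M.eventually_mem_run hd)] with y ⟨ψ, hψ, hψy⟩ hy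
  obtain ⟨d', hd', hyd⟩ := hM y hy ψ hψy n
  obtain rfl := Part.mem_unique hψ hd'
  rw [abs_lt] at *
  constructor <;> linarith [hxd.1, hxd.2, hyd.1, hyd.2]

/-! ### Inverse branches -/

namespace IsExpandingBranchedMap

variable {G : ℝ → ℝ} {ℓ r : ℕ → ℝ}

theorem isOpen_branchDomain (ℓ r : ℕ → ℝ) : IsOpen (branchDomain ℓ r) :=
  isOpen_iUnion fun _ => isOpen_Ioo

theorem branch_subset (ℓ r : ℕ → ℝ) (i : ℕ) : Ioo (ℓ i) (r i) ⊆ branchDomain ℓ r :=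
  subset_iUnion (fun i => Ioo (ℓ i) (r i)) i

theorem branchDomain_subset_unit (hG : IsExpandingBranchedMap G ℓ r) :
    branchDomain ℓ r ⊆ Ioo 0 1 :=
  iUnion_subset hG.subset_unit

theorem branchDomain_subset (hG : IsExpandingBranchedMap G ℓ r) :
    branchDomain ℓ r ⊆ Ioo (leftEnd ℓ r) (rightEnd ℓ r) := by
  have hbdd := hG.branchDomain_subset_unit
  have hb : BddBelow (branchDomain ℓ r) := bddBelow_Ioo.mono hbdd
  have ha : BddAbove (branchDomain ℓ r) := bddAbove_Ioo.mono hbdd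
  intro x hx
  obtain ⟨i, hi⟩ := mem_iUnion.1 hx
  obtain ⟨y, hy1, hy2⟩ := exists_between hi.1
  obtain ⟨z, hz1, hz2⟩ := exists_between hi.2
  exact ⟨(csInf_le hb (branch_subset ℓ r i ⟨hy1, hy2.trans hi.2⟩)).trans_lt hy2,
    hz1.trans_le (le_csSup ha (branch_subset ℓ r i ⟨hi.1.trans hz1, hz2⟩))⟩

theorem leftEnd_le_left (hG : IsExpandingBranchedMap G ℓ r) (i : ℕ) : leftEnd ℓ r ≤ ℓ i := by
  refine le_of_forall_gt fun y hy => ?_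
  obtain ⟨z, hz1, hz2⟩ := exists_between (lt_min hy (hG.left_lt_right i))
  exact (hG.branchDomain_subset
    (branch_subset ℓ r i ⟨hz1, hz2.trans_le (min_le_right _ _)⟩)).1.trans
      (hz2.trans_le (min_le_left _ _))

theorem leftEnd_lt_left (hG : IsExpandingBranchedMap G ℓ r) (i : ℕ) : leftEnd ℓ r < ℓ i :=
  (hG.leftEnd_le_left (i + 1)).trans_lt (hG.left_strictAnti (Nat.lt_succ_self i))

theorem left_pos (hG : IsExpandingBranchedMap G ℓ r) (i : ℕ) : 0 < ℓ i := by
  have h0 : 0 ≤ ℓ (i + 1) := by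
    by_contra! h
    obtain ⟨z, hz1, hz2⟩ := exists_between (lt_min h (hG.left_lt_right (i + 1)))
    exact absurd (hG.subset_unit (i + 1) ⟨hz1, hz2.trans_le (min_le_right _ _)⟩).1
      (hz2.trans_le (min_le_left _ _)).not_gt
  exact h0.trans_lt (hG.left_strictAnti (Nat.lt_succ_self i))

theorem left_mem (hG : IsExpandingBranchedMap G ℓ r) (i : ℕ) :
    ℓ i ∈ Ioo (leftEnd ℓ r) (rightEnd ℓ r) := by
  obtain ⟨z, hz⟩ := exists_between (hG.left_lt_right i)
  exact ⟨hG.leftEnd_lt_left i, hz.1.trans (hG.branchDomain_subset (branch_subset ℓ r i hz)).2⟩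

theorem right_le_left (hG : IsExpandingBranchedMap G ℓ r) {i j : ℕ} (h : i < j) :
    r j ≤ ℓ i := by
  by_contra! hlt
  have h1 := hG.left_strictAnti h
  obtain ⟨z, hz1, hz2⟩ := exists_between (lt_min hlt (hG.left_lt_right i))
  exact Set.disjoint_left.1 (hG.disjoint h.ne)
    ⟨hz1, hz2.trans_le (min_le_right _ _)⟩ ⟨h1.trans hz1, hz2.trans_le (min_le_left _ _)⟩

theorem differentiableAt (hG : IsExpandingBranchedMap G ℓ r) {x : ℝ}
    (hx : x ∈ branchDomain ℓ r) : DifferentiableAt ℝ G x :=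
  (hG.contDiffOn.differentiableOn one_ne_zero).differentiableAt
    ((isOpen_branchDomain ℓ r).mem_nhds hx)

/-- By the mean value theorem, a lower bound for `|G'|` on an interval inside a branch is an
expansion factor there. -/
theorem mul_abs_sub_le (hG : IsExpandingBranchedMap G ℓ r) {A : Set ℝ} (hA : A.OrdConnected)
    {c : ℝ} {i : ℕ} (hAi : A ⊆ Ioo (ℓ i) (r i)) (hc : ∀ x ∈ A, c ≤ |deriv G x|)
    {x y : ℝ} (hx : x ∈ A) (hy : y ∈ A) : c * |x - y| ≤ |G x - G y| := by
  wlog hxy : x < y generalizing x y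
  · rcases (not_lt.1 hxy).eq_or_lt with rfl | h
    · simp
    · rw [abs_sub_comm x, abs_sub_comm (G x)]; exact this hy hx h
  have hsub : Icc x y ⊆ A := hA.out hx hy
  have hd : ∀ z ∈ Icc x y, DifferentiableAt ℝ G z := fun z hz =>
    hG.differentiableAt (branch_subset ℓ r i (hAi (hsub hz)))
  obtain ⟨z, hz, hzd⟩ := exists_deriv_eq_slope G hxy
    (fun z hz => (hd z hz).continuousAt.continuousWithinAt)
    (fun z hz => (hd z (Ioo_subset_Icc_self hz)).differentiableWithinAt)
  have h1 := hc z (hsub (Ioo_subset_Icc_self hz))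
  rw [hzd, abs_div, le_div_iff₀ (abs_pos.2 (sub_pos.2 hxy).ne')] at h1
  rwa [abs_sub_comm x, abs_sub_comm (G x)]

theorem abs_sub_le (hG : IsExpandingBranchedMap G ℓ r) {i : ℕ} {x y : ℝ}
    (hx : x ∈ Ioo (ℓ i) (r i)) (hy : y ∈ Ioo (ℓ i) (r i)) : |x - y| ≤ |G x - G y| := by
  simpa using hG.mul_abs_sub_le ordConnected_Ioo subset_rfl
    (fun z hz => (hG.one_lt_abs_deriv z (branch_subset ℓ r i hz)).le) hx hy

theorem inverseBranch_mem (hG : IsExpandingBranchedMap G ℓ r) (i : ℕ) {z : ℝ}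
    (hz : z ∈ Ioo (leftEnd ℓ r) (rightEnd ℓ r)) : inverseBranch G ℓ r i z ∈ Ioo (ℓ i) (r i) :=
  Function.invFunOn_mem ((hG.image_branch i).symm ▸ hz : z ∈ G '' Ioo (ℓ i) (r i))

theorem apply_inverseBranch (hG : IsExpandingBranchedMap G ℓ r) (i : ℕ) {z : ℝ}
    (hz : z ∈ Ioo (leftEnd ℓ r) (rightEnd ℓ r)) : G (inverseBranch G ℓ r i z) = z :=
  Function.invFunOn_eq ((hG.image_branch i).symm ▸ hz : z ∈ G '' Ioo (ℓ i) (r i))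

theorem inverseBranch_mem_Ioo (hG : IsExpandingBranchedMap G ℓ r) (i : ℕ) {z : ℝ}
    (hz : z ∈ Ioo (leftEnd ℓ r) (rightEnd ℓ r)) :
    inverseBranch G ℓ r i z ∈ Ioo (leftEnd ℓ r) (rightEnd ℓ r) :=
  hG.branchDomain_subset (branch_subset ℓ r i (hG.inverseBranch_mem i hz))

theorem mapsTo_iterate_inverseBranch (hG : IsExpandingBranchedMap G ℓ r) (i m : ℕ) :
    MapsTo (inverseBranch G ℓ r i)^[m] (Ioo (leftEnd ℓ r) (rightEnd ℓ r))
      (Ioo (leftEnd ℓ r) (rightEnd ℓ r)) :=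
  MapsTo.iterate (fun _ hz => hG.inverseBranch_mem_Ioo i hz) m

theorem abs_inverseBranch_sub_le (hG : IsExpandingBranchedMap G ℓ r) (i : ℕ) {z w : ℝ}
    (hz : z ∈ Ioo (leftEnd ℓ r) (rightEnd ℓ r)) (hw : w ∈ Ioo (leftEnd ℓ r) (rightEnd ℓ r)) :
    |inverseBranch G ℓ r i z - inverseBranch G ℓ r i w| ≤ |z - w| := by
  have := hG.abs_sub_le (hG.inverseBranch_mem i hz) (hG.inverseBranch_mem i hw)
  rwa [hG.apply_inverseBranch i hz, hG.apply_inverseBranch i hw] at this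

theorem inverseBranch_zero_lt (hG : IsExpandingBranchedMap G ℓ r) {z w : ℝ}
    (hz : z ∈ Ioo (leftEnd ℓ r) (rightEnd ℓ r)) (hw : w ∈ Ioo (leftEnd ℓ r) (rightEnd ℓ r))
    (h : z < w) : inverseBranch G ℓ r 0 w < inverseBranch G ℓ r 0 z := by
  rw [← hG.first_decreasing.lt_iff_gt (hG.inverseBranch_mem 0 hz) (hG.inverseBranch_mem 0 hw),
    hG.apply_inverseBranch 0 hz, hG.apply_inverseBranch 0 hw]
  exact h

/-- The points of the branches accumulate at the left end. -/
theorem tendsto_inverseBranch_apply (hG : IsExpandingBranchedMap G ℓ r) {z : ℝ}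
    (hz : z ∈ Ioo (leftEnd ℓ r) (rightEnd ℓ r)) :
    Tendsto (fun i => inverseBranch G ℓ r i z) atTop (𝓝[>] leftEnd ℓ r) := by
  refine tendsto_nhdsWithin_iff.2 ⟨?_, Eventually.of_forall fun i =>
    (hG.inverseBranch_mem_Ioo i hz).1⟩
  rw [tendsto_order]
  refine ⟨fun a ha => Eventually.of_forall fun i => ha.trans (hG.inverseBranch_mem_Ioo i hz).1,
    fun a ha => ?_⟩
  obtain ⟨y, hy, hya⟩ := exists_lt_of_csInf_lt
    ⟨_, branch_subset ℓ r 0 (hG.inverseBranch_mem 0 hz)⟩ ha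
  obtain ⟨j, hj⟩ := mem_iUnion.1 hy
  filter_upwards [eventually_gt_atTop j] with i hi
  exact (hG.inverseBranch_mem i hz).2.trans_le
    ((hG.right_le_left hi).trans (hj.1.le.trans hya.le))

/-- The first inverse branch has a fixed point, by the intermediate value theorem for `G` on the
interval between the first two iterates of `ℓ 0` under that inverse branch. -/
theorem exists_fixedPoint (hG : IsExpandingBranchedMap G ℓ r) :
    ∃ p ∈ Ioo (leftEnd ℓ r) (rightEnd ℓ r), inverseBranch G ℓ r 0 p = p := by
  set g := inverseBranch G ℓ r 0
  have hI : ∀ z ∈ Ioo (ℓ 0) (r 0), z ∈ Ioo (leftEnd ℓ r) (rightEnd ℓ r) := fun z hz =>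
    hG.branchDomain_subset (branch_subset ℓ r 0 hz)
  have h1 := hG.left_mem 0
  -- `g (ℓ 0)` and `g (g (ℓ 0))` are the ends of an interval that `g` maps to itself.
  have hb := hG.inverseBranch_mem 0 h1
  have ha := hG.inverseBranch_mem 0 (hI _ hb)
  have hab : g (g (ℓ 0)) < g (ℓ 0) := hG.inverseBranch_zero_lt h1 (hI _ hb) hb.1
  have hsub : Icc (g (g (ℓ 0))) (g (ℓ 0)) ⊆ Ioo (ℓ 0) (r 0) := Icc_subset_Ioo ha.1 hb.2
  have hcont : ContinuousOn G (Icc (g (g (ℓ 0))) (g (ℓ 0))) := fun z hz =>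
    (hG.differentiableAt (branch_subset ℓ r 0 (hsub hz))).continuousAt.continuousWithinAt
  have e1 : G (g (ℓ 0)) = ℓ 0 := hG.apply_inverseBranch 0 h1
  have e2 : G (g (g (ℓ 0))) = g (ℓ 0) := hG.apply_inverseBranch 0 (hI _ hb)
  obtain ⟨p, hp, hp0⟩ := intermediate_value_Icc' hab.le (hcont.sub continuousOn_id)
    (show (0 : ℝ) ∈ _ by
      simp only [Pi.sub_apply, id]
      rw [e1, e2]
      exact ⟨by linarith [hb.1], by linarith⟩)
  have hGp : G p = p := sub_eq_zero.1 hp0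
  refine ⟨p, hI _ (hsub hp), ?_⟩
  refine hG.first_decreasing.injOn (hG.inverseBranch_mem 0 (hI _ (hsub hp))) (hsub hp) ?_
  rw [hG.apply_inverseBranch 0 (hI _ (hsub hp)), hGp]

/-- Two consecutive visits to `J 0` keep a point away from the right end of `J 0`: the second visit
says that the image is larger than `ℓ 0`, and the first branch is decreasing. -/
theorem inverseBranch_zero_lt_of_mem (hG : IsExpandingBranchedMap G ℓ r) {z : ℝ}
    (hz : z ∈ Ioo (ℓ 0) (r 0)) : inverseBranch G ℓ r 0 z < inverseBranch G ℓ r 0 (ℓ 0) :=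
  hG.inverseBranch_zero_lt (hG.left_mem 0)
    (hG.branchDomain_subset (branch_subset ℓ r 0 hz)) hz.1

/-- The iterates of the first inverse branch converge to its fixed point, uniformly. After three
steps all orbits are in a compact part of `J 0`, where `|G'|` is bounded below by a
constant larger than `1`. -/
theorem exists_iterate_inverseBranch_le (hG : IsExpandingBranchedMap G ℓ r) {p : ℝ}
    (hpI : p ∈ Ioo (leftEnd ℓ r) (rightEnd ℓ r)) (hp : inverseBranch G ℓ r 0 p = p) :
    ∃ c > 1, ∀ z ∈ Ioo (leftEnd ℓ r) (rightEnd ℓ r), ∀ m : ℕ,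
      c ^ m * |(inverseBranch G ℓ r 0)^[m + 3] z - p| ≤ 1 := by
  set g := inverseBranch G ℓ r 0 with hg
  have hI : ∀ z ∈ Ioo (ℓ 0) (r 0), z ∈ Ioo (leftEnd ℓ r) (rightEnd ℓ r) := fun z hz =>
    hG.branchDomain_subset (branch_subset ℓ r 0 hz)
  have h1 := hG.left_mem 0
  have hb := hG.inverseBranch_mem 0 h1
  have ha := hG.inverseBranch_mem 0 (hI _ hb)
  have hab : g (g (ℓ 0)) < g (ℓ 0) := hG.inverseBranch_zero_lt h1 (hI _ hb) hb.1
  have hsub : Icc (g (g (ℓ 0))) (g (ℓ 0)) ⊆ Ioo (ℓ 0) (r 0) := Icc_subset_Ioo ha.1 hb.2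
  have hcont : ContinuousOn (fun z => |deriv G z|) (Icc (g (g (ℓ 0))) (g (ℓ 0))) :=
    ((hG.contDiffOn.continuousOn_deriv_of_isOpen (isOpen_branchDomain ℓ r) le_rfl).mono
      (hsub.trans (branch_subset ℓ r 0))).abs
  obtain ⟨x₀, hx₀, hmin⟩ := isCompact_Icc.exists_isMinOn (nonempty_Icc.2 hab.le) hcont
  have hK : ∀ z ∈ Ioo (leftEnd ℓ r) (rightEnd ℓ r), g (g (g z)) ∈ Icc (g (g (ℓ 0))) (g (ℓ 0)) := by
    intro z hz
    have m1 := hG.inverseBranch_mem 0 hz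
    have m2 := hG.inverseBranch_mem 0 (hI _ m1)
    exact ⟨(hG.inverseBranch_zero_lt (hI _ m2) (hI _ hb) (hG.inverseBranch_zero_lt_of_mem m1)).le,
      (hG.inverseBranch_zero_lt_of_mem m2).le⟩
  have hpK : p ∈ Icc (g (g (ℓ 0))) (g (ℓ 0)) := by
    have := hK p hpI
    rwa [hp, hp, hp] at this
  refine ⟨|deriv G x₀|, hG.one_lt_abs_deriv _ (branch_subset ℓ r 0 (hsub hx₀)), fun z hz m => ?_⟩
  have hGp : G p = p := by
    conv_lhs => rw [← hp]
    exact hG.apply_inverseBranch 0 hpI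
  have hit : ∀ m, g^[m + 3] z ∈ Icc (g (g (ℓ 0))) (g (ℓ 0)) := by
    intro m
    rw [add_comm, Function.iterate_add_apply]
    exact hK _ (hG.mapsTo_iterate_inverseBranch 0 m hz)
  induction m with
  | zero =>
    have e1 := hG.subset_unit 0 (hsub (hit 0))
    have e2 := hG.subset_unit 0 (hsub hpK)
    rw [pow_zero, one_mul, abs_le]
    constructor <;> linarith [e1.1, e1.2, e2.1, e2.2]
  | succ m ih =>
    refine le_trans ?_ ih
    have := hG.mul_abs_sub_le ordConnected_Icc hsub (fun z hz => hmin hz) (hit (m + 1)) hpK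
    rw [hGp, show m + 1 + 3 = (m + 3) + 1 by ring, Function.iterate_succ_apply',
      hg, hG.apply_inverseBranch 0 (hI _ (hsub (hit m)))] at this
    rw [pow_succ, mul_assoc]
    rw [show m + 1 + 3 = (m + 3) + 1 by ring, Function.iterate_succ_apply']
    gcongr

theorem tendsto_iterate_inverseBranch (hG : IsExpandingBranchedMap G ℓ r) {p : ℝ}
    (hpI : p ∈ Ioo (leftEnd ℓ r) (rightEnd ℓ r)) (hp : inverseBranch G ℓ r 0 p = p)
    {z : ℕ → ℝ} (hz : ∀ N, z N ∈ Ioo (leftEnd ℓ r) (rightEnd ℓ r))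
    {m : ℕ → ℕ} (hm : Tendsto m atTop atTop) :
    Tendsto (fun N => (inverseBranch G ℓ r 0)^[m N] (z N)) atTop (𝓝 p) := by
  obtain ⟨c, hc, h⟩ := hG.exists_iterate_inverseBranch_le hpI hp
  rw [tendsto_iff_dist_tendsto_zero]
  have h1 : Tendsto (fun N => (c ^ (m N - 3))⁻¹) atTop (𝓝 0) :=
    ((tendsto_pow_atTop_atTop_of_one_lt hc).comp
      ((tendsto_sub_atTop_nat 3).comp hm)).inv_tendsto_atTop
  refine squeeze_zero' (Eventually.of_forall fun _ => dist_nonneg) ?_ h1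
  filter_upwards [hm.eventually_ge_atTop 3] with N hN
  have := h (z N) (hz N) (m N - 3)
  rw [Nat.sub_add_cancel hN] at this
  rw [Real.dist_eq, ← one_div, le_div_iff₀ (by positivity), mul_comm]
  exact this

end IsExpandingBranchedMap

/-! ### Compositions of inverse branches -/

/-- `h` is a composition of `n` inverse branches of `G`, so that it is a right inverse of `G^[n]`
on `(s₀, s₁)`, with a cylinder of order `n` as its range. -/
inductive IsInverseIterate (G : ℝ → ℝ) (ℓ r : ℕ → ℝ) : ℕ → (ℝ → ℝ) → Prop
  | id : IsInverseIterate G ℓ r 0 id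
  | comp {n : ℕ} {h : ℝ → ℝ} (i : ℕ) (hh : IsInverseIterate G ℓ r n h) :
      IsInverseIterate G ℓ r (n + 1) (h ∘ inverseBranch G ℓ r i)

namespace IsInverseIterate

variable {G : ℝ → ℝ} {ℓ r : ℕ → ℝ} {n : ℕ} {h : ℝ → ℝ}

theorem iterate_comp (hh : IsInverseIterate G ℓ r n h) (i m : ℕ) :
    IsInverseIterate G ℓ r (n + m) (h ∘ (inverseBranch G ℓ r i)^[m]) := by
  induction m with
  | zero => exact hh
  | succ m ih =>
    rw [Function.iterate_succ, ← Function.comp_assoc]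
    exact ih.comp i

theorem iterate_apply (hh : IsInverseIterate G ℓ r n h) (hG : IsExpandingBranchedMap G ℓ r) {z : ℝ}
    (hz : z ∈ Ioo (leftEnd ℓ r) (rightEnd ℓ r)) : G^[n] (h z) = z := by
  induction hh generalizing z with
  | id => rfl
  | comp i _ ih =>
    rw [Function.iterate_succ_apply', Function.comp_apply, ih (hG.inverseBranch_mem_Ioo i hz),
      hG.apply_inverseBranch i hz]

theorem iterate_apply_mem (hh : IsInverseIterate G ℓ r n h) (hG : IsExpandingBranchedMap G ℓ r)
    {z : ℝ} (hz : z ∈ Ioo (leftEnd ℓ r) (rightEnd ℓ r)) {j : ℕ} (hj : j < n) :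
    G^[j] (h z) ∈ branchDomain ℓ r := by
  induction hh generalizing z with
  | id => exact absurd hj (Nat.not_lt_zero j)
  | comp i hh ih =>
    rcases Nat.lt_succ_iff_lt_or_eq.1 hj with hj | rfl
    · exact ih (hG.inverseBranch_mem_Ioo i hz) hj
    · rw [Function.comp_apply, hh.iterate_apply hG (hG.inverseBranch_mem_Ioo i hz)]
      exact IsExpandingBranchedMap.branch_subset ℓ r i (hG.inverseBranch_mem i hz)

theorem abs_sub_le (hh : IsInverseIterate G ℓ r n h) (hG : IsExpandingBranchedMap G ℓ r) {z w : ℝ}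
    (hz : z ∈ Ioo (leftEnd ℓ r) (rightEnd ℓ r)) (hw : w ∈ Ioo (leftEnd ℓ r) (rightEnd ℓ r)) :
    |h z - h w| ≤ |z - w| := by
  induction hh generalizing z w with
  | id => rfl
  | comp i _ ih =>
    exact (ih (hG.inverseBranch_mem_Ioo i hz) (hG.inverseBranch_mem_Ioo i hw)).trans
      (hG.abs_inverseBranch_sub_le i hz hw)

theorem iterate_apply_fixedPoint (hh : IsInverseIterate G ℓ r n h)
    (hG : IsExpandingBranchedMap G ℓ r) {p : ℝ} (hpI : p ∈ Ioo (leftEnd ℓ r) (rightEnd ℓ r))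
    (hp : inverseBranch G ℓ r 0 p = p) {k : ℕ} (hk : n ≤ k) : G^[k] (h p) = p := by
  obtain ⟨j, rfl⟩ := Nat.exists_eq_add_of_le' hk
  have hGp : G p = p := by
    conv_lhs => rw [← hp]
    exact hG.apply_inverseBranch 0 hpI
  rw [Function.iterate_add_apply, hh.iterate_apply hG hpI]
  exact Function.iterate_fixed hGp j

theorem mem_invariantSet (hh : IsInverseIterate G ℓ r n h)
    (hG : IsExpandingBranchedMap G ℓ r) {p : ℝ} (hpI : p ∈ Ioo (leftEnd ℓ r) (rightEnd ℓ r))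
    (hp : inverseBranch G ℓ r 0 p = p) : h p ∈ invariantSet G ℓ r := by
  intro j
  rcases lt_or_ge j n with hj | hj
  · exact hh.iterate_apply_mem hG hpI hj
  · rw [hh.iterate_apply_fixedPoint hG hpI hp hj, ← hp]
    exact IsExpandingBranchedMap.branch_subset ℓ r 0 (hG.inverseBranch_mem 0 hpI)

end IsInverseIterate

/-! ### Continuity of the iterates and bounds for the weight -/

section

variable {G u : ℝ → ℝ} {ℓ r : ℕ → ℝ}

theorem invariantSet_subset_iterateDomain (n : ℕ) :
    invariantSet G ℓ r ⊆ iterateDomain G ℓ r n :=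
  fun _ hx j _ => hx j

theorem IsExpandingBranchedMap.continuousAt_iterate (hG : IsExpandingBranchedMap G ℓ r) {n : ℕ}
    {x : ℝ} (hx : x ∈ iterateDomain G ℓ r n) : ContinuousAt G^[n] x := by
  induction n with
  | zero => exact continuousAt_id
  | succ n ih =>
    rw [Function.iterate_succ']
    exact (hG.differentiableAt (hx n n.lt_succ_self)).continuousAt.comp
      (ih fun j hj => hx j (hj.trans n.lt_succ_self))

theorem IsExpandingBranchedMap.isOpen_iterateDomain (hG : IsExpandingBranchedMap G ℓ r) (n : ℕ) :
    IsOpen (iterateDomain G ℓ r n) := by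
  refine isOpen_iff_mem_nhds.2 fun x hx => ?_
  have h1 : ∀ j ∈ Finset.range n, ∀ᶠ y in 𝓝 x, G^[j] y ∈ branchDomain ℓ r := by
    intro j hj
    have hj := Finset.mem_range.1 hj
    exact (hG.continuousAt_iterate fun i hi => hx i (hi.trans hj)).eventually_mem
      ((isOpen_branchDomain ℓ r).mem_nhds (hx j hj))
  filter_upwards [(Finset.eventually_all _).2 h1] with y hy j hj
  exact hy j (Finset.mem_range.2 hj)

theorem IsExpandingBranchedMap.iterate_mem_Ioo (hG : IsExpandingBranchedMap G ℓ r) {x : ℝ}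
    (hx : x ∈ invariantSet G ℓ r) (j : ℕ) : G^[j] x ∈ Ioo 0 1 :=
  hG.branchDomain_subset_unit (hx j)

/-- The one-sided bound on `u'` keeps `u` bounded above away from the left end, in particular
near the right end. -/
theorem IsBrjunoWeight.exists_le_of_lt {s₀ s₁ a : ℝ} (hu : IsBrjunoWeight u s₀ s₁)
    (ha : a ∈ Ioo s₀ s₁) : ∃ B, ∀ x ∈ Ioo a s₁, u x ≤ B := by
  obtain ⟨C, hC, hC'⟩ := hu.deriv_lt
  have ha0 : 0 < a - s₀ := sub_pos.2 ha.1
  have hK : 0 < C / (a - s₀) ^ 2 := by positivity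
  refine ⟨u a + C / (a - s₀) ^ 2 * (s₁ - a), fun x hx => ?_⟩
  have hsub : Icc a x ⊆ Ioo s₀ s₁ := Icc_subset_Ioo ha.1 hx.2
  have hdiff : DifferentiableOn ℝ u (Ioo s₀ s₁) := hu.contDiffOn.differentiableOn one_ne_zero
  have h1 : u x - u a ≤ C / (a - s₀) ^ 2 * (x - a) := by
    refine (convex_Icc a x).image_sub_le_mul_sub_of_deriv_le (hdiff.continuousOn.mono hsub)
      (hdiff.mono (interior_subset.trans hsub)) (fun y hy => ?_) a (left_mem_Icc.2 hx.1.le) x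
      (right_mem_Icc.2 hx.1.le) hx.1.le
    rw [interior_Icc] at hy
    refine (hC' y (hsub (Ioo_subset_Icc_self hy))).le.trans ?_
    gcongr
    exact hy.1.le
  nlinarith [hx.2]

theorem IsBrjunoWeight.exists_le_branch (hG : IsExpandingBranchedMap G ℓ r)
    (hu : IsBrjunoWeight u (leftEnd ℓ r) (rightEnd ℓ r)) (i : ℕ) :
    ∃ B, ∀ x ∈ Ioo (ℓ i) (r i), u x ≤ B := by
  obtain ⟨B, h⟩ := hu.exists_le_of_lt (hG.left_mem i)
  exact ⟨B, fun x hx => h x ⟨hx.1,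
    (hG.branchDomain_subset (IsExpandingBranchedMap.branch_subset ℓ r i hx)).2⟩⟩

theorem IsInverseIterate.exists_le {n : ℕ} {h : ℝ → ℝ} (hh : IsInverseIterate G ℓ r n h)
    (hG : IsExpandingBranchedMap G ℓ r)
    (hu : IsBrjunoWeight u (leftEnd ℓ r) (rightEnd ℓ r)) :
    ∃ B, ∀ z ∈ Ioo (leftEnd ℓ r) (rightEnd ℓ r), ∀ j < n, u (G^[j] (h z)) ≤ B := by
  induction hh with
  | id => exact ⟨1, fun z _ j hj => absurd hj (Nat.not_lt_zero j)⟩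
  | comp i hh ih =>
    obtain ⟨B, h1⟩ := ih
    obtain ⟨B', h2⟩ := IsBrjunoWeight.exists_le_branch hG hu i
    refine ⟨max B B', fun z hz j hj => ?_⟩
    have hgz := hG.inverseBranch_mem_Ioo i hz
    rcases Nat.lt_succ_iff_lt_or_eq.1 hj with hj | rfl
    · exact (h1 _ hgz j hj).trans (le_max_left _ _)
    · rw [Function.comp_apply, hh.iterate_apply hG hgz]
      exact (h2 _ (hG.inverseBranch_mem i hz)).trans (le_max_right _ _)

/-! ### The terms of the series -/

/-- The term of index `k` of the series that defines the generalized Brjuno function. -/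
noncomputable def brjunoTerm (G u : ℝ → ℝ) (ν : ℝ) (s : ℕ → ℝ) (x : ℝ) (k : ℕ) : ℝ :=
  s k * (∏ j ∈ Finset.range k, G^[j] x) ^ ν * u (G^[k] x)

variable {ν : ℝ} {s : ℕ → ℝ}

theorem continuousAt_prod_iterate (hG : IsExpandingBranchedMap G ℓ r) {x : ℝ}
    (hx : x ∈ invariantSet G ℓ r) (k : ℕ) :
    ContinuousAt (fun y => ∏ j ∈ Finset.range k, G^[j] y) x :=
  tendsto_finsetProd _ fun j _ =>
    hG.continuousAt_iterate (invariantSet_subset_iterateDomain j hx)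

theorem continuousAt_brjunoTerm (hG : IsExpandingBranchedMap G ℓ r)
    (hu : IsBrjunoWeight u (leftEnd ℓ r) (rightEnd ℓ r)) (hν : 0 < ν) {x : ℝ}
    (hx : x ∈ invariantSet G ℓ r) (k : ℕ) :
    ContinuousAt (fun y => brjunoTerm G u ν s y k) x := by
  have h1 : ContinuousAt u (G^[k] x) :=
    (hu.contDiffOn.continuousOn).continuousAt
      (isOpen_Ioo.mem_nhds (hG.branchDomain_subset (hx k)))
  exact (continuousAt_const.mul ((continuousAt_prod_iterate hG hx k).rpow_const
    (Or.inr hν.le))).mul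
    (h1.comp (hG.continuousAt_iterate (invariantSet_subset_iterateDomain k hx)))

theorem abs_brjunoTerm (hG : IsExpandingBranchedMap G ℓ r)
    (hu : IsBrjunoWeight u (leftEnd ℓ r) (rightEnd ℓ r)) (hs : ∀ k, s k = 1 ∨ s k = -1) {x : ℝ}
    (hx : x ∈ invariantSet G ℓ r) (k : ℕ) :
    |brjunoTerm G u ν s x k| = (∏ j ∈ Finset.range k, G^[j] x) ^ ν * u (G^[k] x) := by
  have h1 : |s k| = 1 := by rcases hs k with h | h <;> simp [h]
  have h2 : 0 ≤ ∏ j ∈ Finset.range k, G^[j] x :=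
    Finset.prod_nonneg fun j _ => (hG.iterate_mem_Ioo hx j).1.le
  rw [brjunoTerm, abs_mul, abs_mul, h1, one_mul, abs_of_nonneg (Real.rpow_nonneg h2 ν),
    abs_of_pos (hu.pos _ (hG.branchDomain_subset (hx k)))]

/-- A product of `k` factors from `[0, 1]`, all but `e` of which are at most `θ`. -/
theorem prod_range_le_pow_div {f : ℕ → ℝ} {θ : ℝ} (hf0 : ∀ j, 0 ≤ f j) (hf1 : ∀ j, f j ≤ 1)
    (hθ0 : 0 < θ) (hθ1 : θ ≤ 1) (E : Finset ℕ) (hE : ∀ j ∉ E, f j ≤ θ) {e : ℕ} (he : E.card ≤ e)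
    (k : ℕ) : ∏ j ∈ Finset.range k, f j ≤ θ ^ k / θ ^ e := by
  rw [le_div_iff₀ (by positivity)]
  have h1 : ∏ j ∈ Finset.range k, f j ≤ ∏ j ∈ Finset.range k, if j ∈ E then 1 else θ :=
    Finset.prod_le_prod (fun j _ => hf0 j) fun j _ => by
      split_ifs with h
      · exact hf1 j
      · exact hE j h
  have h2 : θ ^ e ≤ ∏ j ∈ Finset.range k, if j ∈ E then θ else 1 := by
    rw [Finset.prod_ite, Finset.prod_const, Finset.prod_const_one, mul_one]
    refine pow_le_pow_of_le_one hθ0.le hθ1 (le_trans (Finset.card_le_card ?_) he)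
    exact fun j hj => (Finset.mem_filter.1 hj).2
  calc (∏ j ∈ Finset.range k, f j) * θ ^ e
      ≤ (∏ j ∈ Finset.range k, if j ∈ E then 1 else θ) *
        ∏ j ∈ Finset.range k, if j ∈ E then θ else 1 := by
        refine mul_le_mul h1 h2 (by positivity) (Finset.prod_nonneg fun j _ => ?_)
        split_ifs <;> positivity
    _ = θ ^ k := by
        rw [← Finset.prod_mul_distrib]
        conv_rhs => rw [← Finset.card_range k, ← Finset.prod_const]
        refine Finset.prod_congr rfl fun j _ => ?_
        split_ifs <;> simp

theorem summable_geometric_rpow {θ : ℝ} (hθ0 : 0 < θ) (hθ1 : θ < 1) (hν : 0 < ν) (e : ℕ) (B : ℝ) :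
    Summable fun k : ℕ => (θ ^ k / θ ^ e) ^ ν * B := by
  have h1 : Summable fun k : ℕ => (θ ^ ν) ^ k :=
    summable_geometric_of_lt_one (by positivity) (Real.rpow_lt_one hθ0.le hθ1 hν)
  refine ((h1.mul_right (((θ ^ e) ^ ν)⁻¹ * B))).congr fun k => ?_
  rw [Real.div_rpow (by positivity) (by positivity), Real.rpow_pow_comm hθ0.le]
  ring

theorem abs_brjunoTerm_le (hG : IsExpandingBranchedMap G ℓ r)
    (hu : IsBrjunoWeight u (leftEnd ℓ r) (rightEnd ℓ r)) (hν : 0 < ν)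
    (hs : ∀ k, s k = 1 ∨ s k = -1) {x θ B : ℝ} (hx : x ∈ invariantSet G ℓ r)
    (hθ0 : 0 < θ) (hθ1 : θ < 1) (E : Finset ℕ) (hE : ∀ j ∉ E, G^[j] x ≤ θ) {e : ℕ}
    (he : E.card ≤ e) {k : ℕ} (hB : u (G^[k] x) ≤ B) :
    |brjunoTerm G u ν s x k| ≤ (θ ^ k / θ ^ e) ^ ν * B := by
  rw [abs_brjunoTerm hG hu hs hx]
  have hI := hG.iterate_mem_Ioo hx
  gcongr
  · exact (hu.pos _ (hG.branchDomain_subset (hx k))).le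
  · exact Finset.prod_nonneg fun j _ => (hI j).1.le
  · exact prod_range_le_pow_div (fun j => (hI j).1.le) (fun j => (hI j).2.le) hθ0 hθ1.le E hE he k

theorem tendsto_brjunoPartialSum {x a : ℝ} (h : HasSum (brjunoTerm G u ν s x) a) :
    Tendsto (brjunoPartialSum G u ν s x) atTop (𝓝 a) :=
  h.tendsto_sum_nat

theorem generalizedBrjuno_eq {x a : ℝ} (h : HasSum (brjunoTerm G u ν s x) a) :
    generalizedBrjuno G u ν s x = a :=
  (tendsto_brjunoPartialSum h).limUnder_eq

end

/-! ### Perturbations with a prescribed effect on the sum -/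

section

variable {G u : ℝ → ℝ} {ℓ r : ℕ → ℝ} {ν : ℝ} {s : ℕ → ℝ} {n : ℕ} {h : ℝ → ℝ} {p : ℝ}

theorem IsInverseIterate.iterate_add_apply (hh : IsInverseIterate G ℓ r n h)
    (hG : IsExpandingBranchedMap G ℓ r) {q : ℝ} (hq : q ∈ Ioo (leftEnd ℓ r) (rightEnd ℓ r))
    {j m : ℕ} (hj : j ≤ m) :
    G^[n + j] (h ((inverseBranch G ℓ r 0)^[m] q)) = (inverseBranch G ℓ r 0)^[m - j] q := by
  have := (hh.iterate_comp 0 j).iterate_apply hG (hG.mapsTo_iterate_inverseBranch 0 (m - j) hq)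
  rwa [Function.comp_apply, ← Function.iterate_add_apply, Nat.add_sub_cancel' hj] at this

/-- With the exception of the term of index `n + m`, the terms of the series at the points
`h (g₀^m (g_N p))` are dominated by a geometric series that does not depend on `m` and `N`. -/
theorem IsInverseIterate.exists_dominating (hh : IsInverseIterate G ℓ r n h)
    (hG : IsExpandingBranchedMap G ℓ r)
    (hu : IsBrjunoWeight u (leftEnd ℓ r) (rightEnd ℓ r)) (hν : 0 < ν)
    (hs : ∀ k, s k = 1 ∨ s k = -1)
    (hpI : p ∈ Ioo (leftEnd ℓ r) (rightEnd ℓ r)) (hp : inverseBranch G ℓ r 0 p = p) :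
    ∃ b : ℕ → ℝ, Summable b ∧ (∀ k, |brjunoTerm G u ν s (h p) k| ≤ b k) ∧
      ∀ m N k, k ≠ n + m →
        |brjunoTerm G u ν s (h ((inverseBranch G ℓ r 0)^[m] (inverseBranch G ℓ r N p))) k|
          ≤ b k := by
  obtain ⟨B₁, h1⟩ := hh.exists_le hG hu
  obtain ⟨B₂, h2⟩ := IsBrjunoWeight.exists_le_branch hG hu 0
  have hpJ : p ∈ Ioo (ℓ 0) (r 0) := by
    have := hG.inverseBranch_mem 0 hpI
    rwa [hp] at this
  set g := inverseBranch G ℓ r 0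
  set θ := g (ℓ 0)
  have hθ : θ ∈ Ioo (0 : ℝ) 1 :=
    hG.subset_unit 0 (hG.inverseBranch_mem 0 (hG.left_mem 0))
  have hpθ : p ≤ θ := by
    have : g p < θ := hG.inverseBranch_zero_lt_of_mem hpJ
    rw [hp] at this
    exact this.le
  refine ⟨_, summable_geometric_rpow hθ.1 hθ.2 hν (n + 2) (max B₁ B₂), fun k => ?_,
    fun m N k hk => ?_⟩
  · refine abs_brjunoTerm_le hG hu hν hs (hh.mem_invariantSet hG hpI hp) hθ.1 hθ.2 (Finset.range n)
      (fun j hj => ?_) (by simp) ?_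
    · rw [hh.iterate_apply_fixedPoint hG hpI hp (by simpa using hj)]
      exact hpθ
    · rcases lt_or_ge k n with hk | hk
      · exact (h1 p hpI k hk).trans (le_max_left _ _)
      · rw [hh.iterate_apply_fixedPoint hG hpI hp hk]
        exact (h2 p hpJ).trans (le_max_right _ _)
  · have hq := hG.inverseBranch_mem_Ioo N hpI
    have hy := (hh.iterate_comp 0 m).comp N
    have hfix : ∀ j, n + m < j → G^[j] (h (g^[m] (inverseBranch G ℓ r N p))) = p := fun j hj =>
      hy.iterate_apply_fixedPoint hG hpI hp hj
    -- The factors that may exceed `θ` are those of the prefix, the one just before the digit `N`,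
    -- which can be close to the right end, and the digit itself.
    refine abs_brjunoTerm_le hG hu hν hs (hy.mem_invariantSet hG hpI hp) hθ.1 hθ.2
      (Finset.range n ∪ {n + m - 1, n + m}) (fun j hj => ?_) ?_ ?_
    · simp only [Finset.mem_union, Finset.mem_range, Finset.mem_insert, Finset.mem_singleton,
        not_or, not_lt] at hj
      obtain ⟨hj1, hj2, hj3⟩ := hj
      rcases lt_or_ge (n + m) j with hj4 | hj4
      · exact (hfix j hj4).trans_le hpθ
      · obtain ⟨i, rfl⟩ := Nat.exists_eq_add_of_le hj1
        obtain ⟨a, ha⟩ : ∃ a, m - i = a + 1 + 1 := ⟨m - i - 2, by omega⟩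
        change G^[n + i] (h (g^[m] (inverseBranch G ℓ r N p))) ≤ θ
        rw [hh.iterate_add_apply hG hq (by omega), ha, Function.iterate_succ_apply',
          Function.iterate_succ_apply']
        exact (hG.inverseBranch_zero_lt_of_mem (hG.inverseBranch_mem 0
          (hG.mapsTo_iterate_inverseBranch 0 a hq))).le
    · refine (Finset.card_union_le _ _).trans ?_
      rw [Finset.card_range]
      exact Nat.add_le_add_left (Finset.card_le_two) n
    · rcases lt_or_ge k n with hkn | hkn
      · exact (h1 _ (hG.mapsTo_iterate_inverseBranch 0 m hq) k hkn).trans (le_max_left _ _)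
      · refine le_trans (h2 _ ?_) (le_max_right _ _)
        rcases lt_or_ge (n + m) k with hk4 | hk4
        · exact (hfix k hk4).symm ▸ hpJ
        · obtain ⟨i, rfl⟩ := Nat.exists_eq_add_of_le hkn
          obtain ⟨a, ha⟩ : ∃ a, m - i = a + 1 := ⟨m - i - 1, by omega⟩
          change G^[n + i] (h (g^[m] (inverseBranch G ℓ r N p))) ∈ _
          rw [hh.iterate_add_apply hG hq (by omega), ha, Function.iterate_succ_apply']
          exact hG.inverseBranch_mem 0 (hG.mapsTo_iterate_inverseBranch 0 a hq)

theorem IsInverseIterate.summable_abs_brjunoTerm (hh : IsInverseIterate G ℓ r n h)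
    (hG : IsExpandingBranchedMap G ℓ r)
    (hu : IsBrjunoWeight u (leftEnd ℓ r) (rightEnd ℓ r)) (hν : 0 < ν)
    (hs : ∀ k, s k = 1 ∨ s k = -1)
    (hpI : p ∈ Ioo (leftEnd ℓ r) (rightEnd ℓ r)) (hp : inverseBranch G ℓ r 0 p = p) :
    Summable fun k => |brjunoTerm G u ν s (h p) k| := by
  obtain ⟨b, hb, h1, -⟩ := hh.exists_dominating hG hu hν hs hpI hp
  exact Summable.of_nonneg_of_le (fun _ => abs_nonneg _) h1 hb

/-- The factor `(g₀(q) ⋯ g₀^m(q))^ν u(q)` of the term of index `n + m` at `h (g₀^m q)`, which does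
not depend on `h`. -/
noncomputable def digitWeight (G u : ℝ → ℝ) (ℓ r : ℕ → ℝ) (ν q : ℝ) (m : ℕ) : ℝ :=
  (∏ j ∈ Finset.range m, (inverseBranch G ℓ r 0)^[j + 1] q) ^ ν * u q

theorem IsInverseIterate.abs_brjunoTerm_eq (hh : IsInverseIterate G ℓ r n h)
    (hG : IsExpandingBranchedMap G ℓ r)
    (hu : IsBrjunoWeight u (leftEnd ℓ r) (rightEnd ℓ r))
    (hs : ∀ k, s k = 1 ∨ s k = -1)
    {q : ℝ} (hq : q ∈ Ioo (leftEnd ℓ r) (rightEnd ℓ r)) (m : ℕ)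
    (hy : h ((inverseBranch G ℓ r 0)^[m] q) ∈ invariantSet G ℓ r) :
    |brjunoTerm G u ν s (h ((inverseBranch G ℓ r 0)^[m] q)) (n + m)| =
      (∏ j ∈ Finset.range n, G^[j] (h ((inverseBranch G ℓ r 0)^[m] q))) ^ ν *
        digitWeight G u ℓ r ν q m := by
  have hI := hG.iterate_mem_Ioo hy
  have h1 : ∏ j ∈ Finset.range m, G^[n + j] (h ((inverseBranch G ℓ r 0)^[m] q)) =
      ∏ j ∈ Finset.range m, (inverseBranch G ℓ r 0)^[j + 1] q := by
    rw [← Finset.prod_range_reflect]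
    refine Finset.prod_congr rfl fun j hj => ?_
    have hj := Finset.mem_range.1 hj
    rw [hh.iterate_add_apply hG hq (by omega)]
    congr 2
    omega
  rw [abs_brjunoTerm hG hu hs hy, hh.iterate_add_apply hG hq le_rfl, Finset.prod_range_add,
    Real.mul_rpow (Finset.prod_nonneg fun j _ => (hI j).1.le)
      (Finset.prod_nonneg fun j _ => (hI _).1.le), h1, digitWeight, Nat.sub_self, mul_assoc]
  rfl

theorem mul_digitWeight_le (hG : IsExpandingBranchedMap G ℓ r)
    (hu : IsBrjunoWeight u (leftEnd ℓ r) (rightEnd ℓ r)) (hν : 0 < ν)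
    {q : ℝ} (hq : q ∈ Ioo (leftEnd ℓ r) (rightEnd ℓ r)) (m : ℕ) :
    ℓ 0 ^ ν * digitWeight G u ℓ r ν q m ≤ digitWeight G u ℓ r ν q (m + 1) := by
  have hJ : ∀ j, (inverseBranch G ℓ r 0)^[j + 1] q ∈ Ioo (ℓ 0) (r 0) := fun j => by
    rw [Function.iterate_succ_apply']
    exact hG.inverseBranch_mem 0 (hG.mapsTo_iterate_inverseBranch 0 j hq)
  have h0 := (hG.left_pos 0).le
  have hP : 0 ≤ ∏ j ∈ Finset.range m, (inverseBranch G ℓ r 0)^[j + 1] q :=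
    Finset.prod_nonneg fun j _ => h0.trans (hJ j).1.le
  rw [digitWeight, digitWeight, ← mul_assoc, ← Real.mul_rpow h0 hP, Finset.prod_range_succ, mul_comm (ℓ 0)]
  gcongr
  · exact (hu.pos q hq).le
  · exact (hJ m).1.le

theorem digitWeight_nonneg (hG : IsExpandingBranchedMap G ℓ r)
    (hu : IsBrjunoWeight u (leftEnd ℓ r) (rightEnd ℓ r))
    {q : ℝ} (hq : q ∈ Ioo (leftEnd ℓ r) (rightEnd ℓ r)) (m : ℕ) :
    0 ≤ digitWeight G u ℓ r ν q m := by
  refine mul_nonneg (Real.rpow_nonneg (Finset.prod_nonneg fun j _ => ?_) ν) (hu.pos q hq).le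
  rw [Function.iterate_succ_apply']
  exact (hG.left_pos 0).le.trans
    (hG.inverseBranch_mem 0 (hG.mapsTo_iterate_inverseBranch 0 j hq)).1.le

theorem pow_mul_le_digitWeight (hG : IsExpandingBranchedMap G ℓ r)
    (hu : IsBrjunoWeight u (leftEnd ℓ r) (rightEnd ℓ r)) (hν : 0 < ν)
    {q : ℝ} (hq : q ∈ Ioo (leftEnd ℓ r) (rightEnd ℓ r)) (m : ℕ) :
    (ℓ 0 ^ ν) ^ m * u q ≤ digitWeight G u ℓ r ν q m := by
  induction m with
  | zero => simp [digitWeight]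
  | succ m ih =>
    have h0 : 0 ≤ ℓ 0 ^ ν := Real.rpow_nonneg (hG.left_pos 0).le ν
    calc (ℓ 0 ^ ν) ^ (m + 1) * u q = ℓ 0 ^ ν * ((ℓ 0 ^ ν) ^ m * u q) := by ring
      _ ≤ ℓ 0 ^ ν * digitWeight G u ℓ r ν q m := by gcongr
      _ ≤ _ := mul_digitWeight_le hG hu hν hq m

theorem tendsto_digitWeight (hG : IsExpandingBranchedMap G ℓ r)
    (hu : IsBrjunoWeight u (leftEnd ℓ r) (rightEnd ℓ r)) (hν : 0 < ν)
    {q : ℝ} (hq : q ∈ Ioo (leftEnd ℓ r) (rightEnd ℓ r)) :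
    Tendsto (digitWeight G u ℓ r ν q) atTop (𝓝 0) := by
  have hJ : ∀ j, (inverseBranch G ℓ r 0)^[j + 1] q ∈ Ioo (ℓ 0) (r 0) := fun j => by
    rw [Function.iterate_succ_apply']
    exact hG.inverseBranch_mem 0 (hG.mapsTo_iterate_inverseBranch 0 j hq)
  have hθ := hG.subset_unit 0 (hG.inverseBranch_mem 0 (hG.left_mem 0))
  refine squeeze_zero (digitWeight_nonneg hG hu hq) (fun m => ?_)
    (summable_geometric_rpow hθ.1 hθ.2 hν 1 (u q)).tendsto_atTop_zero
  rw [digitWeight]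
  gcongr
  · exact (hu.pos q hq).le
  · exact Finset.prod_nonneg fun j _ => (hG.subset_unit 0 (hJ j)).1.le
  · refine prod_range_le_pow_div (fun j => (hG.subset_unit 0 (hJ j)).1.le)
      (fun j => (hG.subset_unit 0 (hJ j)).2.le) hθ.1 hθ.2.le {0} (fun j hj => ?_) (by simp) m
    obtain ⟨i, rfl⟩ := Nat.exists_eq_succ_of_ne_zero (by simpa using hj : j ≠ 0)
    rw [Function.iterate_succ_apply']
    exact (hG.inverseBranch_zero_lt_of_mem (hJ i)).le

/-- Since one more step of `g₀` shrinks the weight by a factor that is at least `ℓ₀^ν`, the number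
of steps can be tuned to bring the weight near any given size. -/
theorem exists_digitWeight_mem (hG : IsExpandingBranchedMap G ℓ r)
    (hu : IsBrjunoWeight u (leftEnd ℓ r) (rightEnd ℓ r)) (hν : 0 < ν)
    {q : ℝ} (hq : q ∈ Ioo (leftEnd ℓ r) (rightEnd ℓ r)) {a : ℝ} (ha : 0 < a) :
    ∃ m, digitWeight G u ℓ r ν q m ≤ a ∧ (a < u q → ℓ 0 ^ ν * a ≤ digitWeight G u ℓ r ν q m) := by
  classical
  have hex : ∃ m, digitWeight G u ℓ r ν q m ≤ a :=
    ((tendsto_digitWeight hG hu hν hq).eventually_le_const ha).exists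
  refine ⟨Nat.find hex, Nat.find_spec hex, fun hlt => ?_⟩
  rcases Nat.eq_zero_or_eq_succ_pred (Nat.find hex) with h0 | h0
  · exact absurd (Nat.find_spec hex) (by rw [h0]; simpa [digitWeight] using hlt)
  · have h1 := Nat.find_min hex (h0 ▸ Nat.lt_succ_self _ : (Nat.find hex).pred < Nat.find hex)
    rw [h0]
    refine le_trans ?_ (mul_digitWeight_le hG hu hν hq _)
    exact mul_le_mul_of_nonneg_left (not_le.1 h1).le (Real.rpow_nonneg (hG.left_pos 0).le ν)

/-- Arbitrarily close to `h p` there are points of the same kind at which the terms of the series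
differ from those at `h p` by at most `δ` in `ℓ¹`, while the sum differs by at least `c * δ`.
The constant `c` depends neither on `h` nor on `δ`. -/
theorem IsInverseIterate.exists_perturbation (hh : IsInverseIterate G ℓ r n h)
    (hG : IsExpandingBranchedMap G ℓ r)
    (hu : IsBrjunoWeight u (leftEnd ℓ r) (rightEnd ℓ r)) (hν : 0 < ν)
    (hs : ∀ k, s k = 1 ∨ s k = -1)
    (hpI : p ∈ Ioo (leftEnd ℓ r) (rightEnd ℓ r)) (hp : inverseBranch G ℓ r 0 p = p)
    {δ : ℝ} (hδ : 0 < δ) {V : Set ℝ} (hV : V ∈ 𝓝 (h p)) :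
    ∃ n' h', IsInverseIterate G ℓ r n' h' ∧ h' p ∈ V ∧
      ∑' k, |brjunoTerm G u ν s (h' p) k - brjunoTerm G u ν s (h p) k| ≤ δ ∧
      ℓ 0 ^ ν / 8 * δ ≤ |∑' k, brjunoTerm G u ν s (h' p) k - ∑' k, brjunoTerm G u ν s (h p) k| := by
  obtain ⟨b, hb, hbx, hby⟩ := hh.exists_dominating hG hu hν hs hpI hp
  have hx := hh.mem_invariantSet hG hpI hp
  set F : ℝ → ℝ := fun y => (∏ j ∈ Finset.range n, G^[j] y) ^ ν with hF
  have hFx : 0 < F (h p) :=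
    Real.rpow_pos_of_pos (Finset.prod_pos fun j _ => (hG.iterate_mem_Ioo hx j).1) ν
  have hFc : ContinuousAt F (h p) :=
    (continuousAt_prod_iterate hG hx n).rpow_const (Or.inr hν.le)
  set q : ℕ → ℝ := fun N => inverseBranch G ℓ r N p
  have hq : ∀ N, q N ∈ Ioo (leftEnd ℓ r) (rightEnd ℓ r) := fun N => hG.inverseBranch_mem_Ioo N hpI
  have huq : Tendsto (fun N => u (q N)) atTop atTop :=
    hu.tendsto_atTop.comp (hG.tendsto_inverseBranch_apply hpI)
  -- The new term is about `F (h p)` times its digit weight, which is tuned to make it about `δ / 2`.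
  set a := δ / 2 / F (h p)
  have ha : 0 < a := by positivity
  have hc0 : 0 < ℓ 0 ^ ν := Real.rpow_pos_of_pos (hG.left_pos 0) ν
  have hc1 : ℓ 0 ^ ν < 1 := Real.rpow_lt_one (hG.left_pos 0).le
    (by
      obtain ⟨z, hz⟩ := exists_between (hG.left_lt_right 0)
      exact hz.1.trans (hG.subset_unit 0 hz).2) hν
  choose m hm1 hm2 using fun N => exists_digitWeight_mem hG hu hν (hq N) ha
  -- A larger digit needs more steps to be brought down to size `a`.
  have hm : Tendsto m atTop atTop := by
    refine tendsto_atTop.2 fun K => ?_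
    filter_upwards [huq.eventually_gt_atTop (a / (ℓ 0 ^ ν) ^ K)] with N hN
    by_contra! hlt
    have h1 := (pow_mul_le_digitWeight hG hu hν (hq N) (m N)).trans (hm1 N)
    rw [div_lt_iff₀ (by positivity)] at hN
    have h2 : (ℓ 0 ^ ν) ^ K ≤ (ℓ 0 ^ ν) ^ m N := pow_le_pow_of_le_one hc0.le hc1.le hlt.le
    nlinarith [hu.pos _ (hq N)]
  set y : ℕ → ℝ := fun N => h ((inverseBranch G ℓ r 0)^[m N] (q N)) with hydef
  have hyI : ∀ N, IsInverseIterate G ℓ r (n + m N + 1)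
      ((h ∘ (inverseBranch G ℓ r 0)^[m N]) ∘ inverseBranch G ℓ r N) := fun N =>
    (hh.iterate_comp 0 (m N)).comp N
  have hy : ∀ N, y N ∈ invariantSet G ℓ r := fun N => (hyI N).mem_invariantSet hG hpI hp
  have hyx : Tendsto y atTop (𝓝 (h p)) := by
    have h1 := hG.tendsto_iterate_inverseBranch hpI hp hq hm
    rw [tendsto_iff_dist_tendsto_zero] at h1 ⊢
    exact squeeze_zero (fun _ => dist_nonneg) (fun N => hh.abs_sub_le hG
      (hG.mapsTo_iterate_inverseBranch 0 _ (hq N)) hpI) h1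
  -- All terms but the one of index `n + m N` converge, with a common majorant.
  set t := brjunoTerm G u ν s with ht
  set D : ℕ → ℕ → ℝ := fun N k => |(if k = n + m N then 0 else t (y N) k) - t (h p) k| with hD
  have hDb : ∀ N k, D N k ≤ b k + b k := by
    intro N k
    refine (abs_sub _ _).trans (add_le_add ?_ (hbx k))
    split_ifs with hk
    · rw [abs_zero]; exact (abs_nonneg _).trans (hbx k)
    · exact hby _ _ _ hk
  have hDs : ∀ N, Summable (D N) := fun N =>
    Summable.of_nonneg_of_le (fun _ => abs_nonneg _) (hDb N) (hb.add hb)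
  have hD0 : Tendsto (fun N => ∑' k, D N k) atTop (𝓝 0) := by
    have := tendsto_tsum_of_dominated_convergence (𝓕 := atTop) (f := D) (g := fun _ => (0 : ℝ))
      (hb.add hb) (fun k => ?_) (Eventually.of_forall fun N k => ?_)
    · simpa using this
    · have h1 : Tendsto (fun N => |t (y N) k - t (h p) k|) atTop (𝓝 0) := by
        have := ((continuousAt_brjunoTerm (s := s) hG hu hν hx k).tendsto.comp hyx).sub_const
          (t (h p) k)
        rw [sub_self] at this
        simpa using this.abs
      refine h1.congr' ?_
      filter_upwards [hm.eventually_gt_atTop k] with N hN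
      rw [hD]
      simp only
      rw [if_neg (by omega)]
    · rw [Real.norm_eq_abs, abs_abs]
      exact hDb N k
  have hFy : Tendsto (fun N => F (y N)) atTop (𝓝 (F (h p))) := hFc.tendsto.comp hyx
  obtain ⟨N, hN1, hN2, hN3, hN4, hN5⟩ := ((hyx.eventually_mem hV).and
    ((hD0.eventually_le_const (by positivity : 0 < ℓ 0 ^ ν / 8 * δ)).and
    ((hFy.eventually_const_le (half_lt_self hFx)).and
    ((hFy.eventually_le_const (by linarith : F (h p) < 3 / 2 * F (h p))).and
    (huq.eventually_gt_atTop a))))).exists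
  have hT : |t (y N) (n + m N)| = F (y N) * digitWeight G u ℓ r ν (q N) (m N) :=
    hh.abs_brjunoTerm_eq hG hu hs (hq N) (m N) (hy N)
  have haF : F (h p) * a = δ / 2 := mul_div_cancel₀ _ hFx.ne'
  have hw0 : 0 ≤ digitWeight G u ℓ r ν (q N) (m N) := digitWeight_nonneg hG hu (hq N) (m N)
  have hT1 : |t (y N) (n + m N)| ≤ 3 / 4 * δ := by
    rw [hT]
    calc F (y N) * digitWeight G u ℓ r ν (q N) (m N) ≤ (3 / 2 * F (h p)) * a :=
          mul_le_mul hN4 (hm1 N) hw0 (by positivity)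
      _ = 3 / 4 * δ := by rw [mul_assoc, haF]; ring
  have hT2 : ℓ 0 ^ ν / 4 * δ ≤ |t (y N) (n + m N)| := by
    rw [hT]
    calc ℓ 0 ^ ν / 4 * δ = (F (h p) / 2) * (ℓ 0 ^ ν * a) := by linear_combination -ℓ 0 ^ ν / 2 * haF
      _ ≤ _ := mul_le_mul hN3 (hm2 N hN5) (by positivity) (by linarith)
  have hsx : Summable fun k => |t (h p) k| := hh.summable_abs_brjunoTerm hG hu hν hs hpI hp
  have hsy : Summable fun k => |t (y N) k| := (hyI N).summable_abs_brjunoTerm hG hu hν hs hpI hp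
  have hsingle : HasSum (fun k => if k = n + m N then t (y N) (n + m N) else 0) (t (y N) (n + m N)) :=
    hasSum_ite_eq _ _
  have hsplit : ∀ k, t (y N) k - t (h p) k =
      ((if k = n + m N then 0 else t (y N) k) - t (h p) k) +
        if k = n + m N then t (y N) (n + m N) else 0 := by
    intro k
    split_ifs with hk
    · rw [hk]; ring
    · ring
  refine ⟨_, _, hyI N, hN1, ?_, ?_⟩
  · change ∑' k, |t (y N) k - t (h p) k| ≤ δ
    have h1 : Summable fun k => |t (y N) k - t (h p) k| := (hsy.of_abs.sub hsx.of_abs).abs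
    have h2 : HasSum (fun k => if k = n + m N then |t (y N) (n + m N)| else 0)
      |t (y N) (n + m N)| := hasSum_ite_eq _ _
    calc ∑' k, |t (y N) k - t (h p) k|
        ≤ ∑' k, (D N k + if k = n + m N then |t (y N) (n + m N)| else 0) := by
          refine h1.tsum_le_tsum (fun k => ?_) ((hDs N).add h2.summable)
          rw [hsplit k]
          refine (abs_add_le _ _).trans (add_le_add_right ?_ _)
          split_ifs <;> simp
      _ = ∑' k, D N k + |t (y N) (n + m N)| := by rw [(hDs N).tsum_add h2.summable, h2.tsum_eq]
      _ ≤ δ := by nlinarith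
  · change _ ≤ |∑' k, t (y N) k - ∑' k, t (h p) k|
    have h3 : Summable fun k => (if k = n + m N then 0 else t (y N) k) - t (h p) k :=
      (hDs N).of_abs
    rw [← hsy.of_abs.tsum_sub hsx.of_abs, tsum_congr hsplit, h3.tsum_add hsingle.summable,
      hsingle.tsum_eq]
    have h4 : |∑' k, ((if k = n + m N then 0 else t (y N) k) - t (h p) k)| ≤ ∑' k, D N k := by
      have := norm_tsum_le_tsum_norm (f := fun k =>
        (if k = n + m N then 0 else t (y N) k) - t (h p) k) (hDs N)
      simpa only [Real.norm_eq_abs] using this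
    have h5 := abs_sub_abs_le_abs_sub (t (y N) (n + m N))
      (-∑' k, ((if k = n + m N then 0 else t (y N) k) - t (h p) k))
    rw [abs_neg, sub_neg_eq_add, add_comm (t (y N) (n + m N))] at h5
    linarith

end

/-! ### The category argument -/

section

variable {G u : ℝ → ℝ} {ℓ r : ℕ → ℝ} {ν : ℝ} {s : ℕ → ℝ} {p : ℝ}

theorem norm_lp_one (a : lp (fun _ : ℕ => ℝ) 1) : ‖a‖ = ∑' k, |a k| := by
  simp [lp.norm_eq_tsum_rpow (p := 1) (by norm_num) a]

theorem summable_abs_lp_one (a : lp (fun _ : ℕ => ℝ) 1) : Summable fun k => |a k| := by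
  simpa using (lp.memℓp a).summable (by norm_num)

theorem abs_tsum_sub_le (a b : lp (fun _ : ℕ => ℝ) 1) : |∑' k, a k - ∑' k, b k| ≤ dist a b := by
  rw [dist_eq_norm, norm_lp_one, ← (summable_abs_lp_one a).of_abs.tsum_sub
    (summable_abs_lp_one b).of_abs]
  have := norm_tsum_le_tsum_norm (f := fun k => (a - b) k) (summable_abs_lp_one (a - b))
  exact this

/-- The graph of `x ↦ (terms of the series at x) ∈ ℓ¹` over the points whose orbit under `G` ends
in the fixed point `p`. -/
def termGraph (G u : ℝ → ℝ) (ℓ r : ℕ → ℝ) (ν : ℝ) (s : ℕ → ℝ) (p : ℝ) :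
    Set (ℝ × lp (fun _ : ℕ => ℝ) 1) :=
  {e | ∃ n h, IsInverseIterate G ℓ r n h ∧ e.1 = h p ∧ ∀ k, e.2 k = brjunoTerm G u ν s (h p) k}

theorem IsInverseIterate.exists_mem_termGraph {n : ℕ} {h : ℝ → ℝ}
    (hh : IsInverseIterate G ℓ r n h) (hG : IsExpandingBranchedMap G ℓ r)
    (hu : IsBrjunoWeight u (leftEnd ℓ r) (rightEnd ℓ r)) (hν : 0 < ν)
    (hs : ∀ k, s k = 1 ∨ s k = -1)
    (hpI : p ∈ Ioo (leftEnd ℓ r) (rightEnd ℓ r)) (hp : inverseBranch G ℓ r 0 p = p) :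
    ∃ a : lp (fun _ : ℕ => ℝ) 1, (h p, a) ∈ termGraph G u ℓ r ν s p :=
  ⟨⟨brjunoTerm G u ν s (h p), memℓp_gen
    (by simpa using hh.summable_abs_brjunoTerm hG hu hν hs hpI hp)⟩, n, h, hh, rfl, fun _ => rfl⟩

/-- Each term is continuous on the invariant set, so taking the closure of the graph adds no new
sequence over its points. -/
theorem apply_eq_brjunoTerm_of_mem_closure (hG : IsExpandingBranchedMap G ℓ r)
    (hu : IsBrjunoWeight u (leftEnd ℓ r) (rightEnd ℓ r)) (hν : 0 < ν)
    {e : ℝ × lp (fun _ : ℕ => ℝ) 1} (he : e ∈ closure (termGraph G u ℓ r ν s p))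
    (hx : e.1 ∈ invariantSet G ℓ r) (k : ℕ) : e.2 k = brjunoTerm G u ν s e.1 k := by
  obtain ⟨f, hf, hfe⟩ := mem_closure_iff_seq_limit.1 he
  have h1 : Tendsto (fun i => (f i).2 k) atTop (𝓝 (e.2 k)) := by
    have h2 := (continuous_snd.tendsto e).comp hfe
    rw [tendsto_iff_dist_tendsto_zero] at h2 ⊢
    refine squeeze_zero (fun _ => dist_nonneg) (fun i => ?_) h2
    rw [Real.dist_eq, Function.comp_apply, dist_eq_norm]
    exact lp.norm_apply_le_norm one_ne_zero ((f i).2 - e.2) k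
  have h3 : Tendsto (fun i => brjunoTerm G u ν s (f i).1 k) atTop (𝓝 (brjunoTerm G u ν s e.1 k)) :=
    (continuousAt_brjunoTerm hG hu hν hx k).tendsto.comp ((continuous_fst.tendsto e).comp hfe)
  refine tendsto_nhds_unique h1 (h3.congr fun i => ?_)
  obtain ⟨n, h, -, h4, h5⟩ := hf i
  rw [h4, h5]

theorem hasSum_of_mem_closure (hG : IsExpandingBranchedMap G ℓ r)
    (hu : IsBrjunoWeight u (leftEnd ℓ r) (rightEnd ℓ r)) (hν : 0 < ν)
    {e : ℝ × lp (fun _ : ℕ => ℝ) 1} (he : e ∈ closure (termGraph G u ℓ r ν s p))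
    (hx : e.1 ∈ invariantSet G ℓ r) : HasSum (brjunoTerm G u ν s e.1) (∑' k, e.2 k) := by
  have h1 : brjunoTerm G u ν s e.1 = fun k => e.2 k :=
    funext fun k => (apply_eq_brjunoTerm_of_mem_closure hG hu hν he hx k).symm
  rw [h1]
  exact (summable_abs_lp_one e.2).of_abs.hasSum

theorem exists_mem_termGraph_of_mem_nhds
    (e : closure (termGraph G u ℓ r ν s p)) {U : Set (closure (termGraph G u ℓ r ν s p))}
    (hU : U ∈ 𝓝 e) : ∃ e' ∈ U, (e' : ℝ × lp (fun _ : ℕ => ℝ) 1) ∈ termGraph G u ℓ r ν s p := by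
  obtain ⟨V, hV, hVU⟩ := mem_nhds_subtype _ _ _ |>.1 hU
  obtain ⟨q, hqV, hq⟩ := mem_closure_iff_nhds.1 e.2 V hV
  exact ⟨⟨q, subset_closure hq⟩, hVU hqV, hq⟩

/-- On a set of points where one program computes the sum, the sum depends continuously on the
point alone. Every ball of the graph closure contains perturbations that refute this, so such a set
is nowhere dense. -/
theorem interior_closure_computes_eq_empty (hG : IsExpandingBranchedMap G ℓ r)
    (hu : IsBrjunoWeight u (leftEnd ℓ r) (rightEnd ℓ r)) (hν : 0 < ν)
    (hs : ∀ k, s k = 1 ∨ s k = -1)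
    (hpI : p ∈ Ioo (leftEnd ℓ r) (rightEnd ℓ r)) (hp : inverseBranch G ℓ r 0 p = p)
    {M : OracleProgram} {A : Set ℝ} (hA : A ⊆ invariantSet G ℓ r)
    (hM : ∀ x ∈ A, ∀ φ : ℕ → ℕ, IsOracleFor φ x → ∀ n : ℕ, ∃ d ∈ M.run φ n,
      |generalizedBrjuno G u ν s x - dyadic d| < (2 : ℝ) ^ (-(n : ℤ))) :
    interior (closure {e : closure (termGraph G u ℓ r ν s p) | e.1.1 ∈ A}) = ∅ := by
  rw [eq_empty_iff_forall_notMem]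
  intro e₀ he₀
  -- Some ball lies in the closure of the set, and `e₂` is a point of the set near its centre.
  obtain ⟨e₁, he₁, -⟩ := exists_mem_termGraph_of_mem_nhds e₀ (isOpen_interior.mem_nhds he₀)
  obtain ⟨δ, hδ, hball⟩ := Metric.isOpen_iff.1 isOpen_interior e₁ he₁
  have hcl := hball.trans interior_subset
  have hc0 : 0 < ℓ 0 ^ ν := Real.rpow_pos_of_pos (hG.left_pos 0) ν
  obtain ⟨ε, hε⟩ : ∃ ε, ε = ℓ 0 ^ ν / 8 * (δ / 2) / 8 := ⟨_, rfl⟩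
  have hε0 : 0 < ε := by rw [hε]; positivity
  have hfst : Continuous fun e : closure (termGraph G u ℓ r ν s p) => e.1.1 :=
    continuous_fst.comp continuous_subtype_val
  obtain ⟨e₂, he₂, he₂A⟩ := mem_closure_iff_nhds.1 (hcl (Metric.mem_ball_self hδ))
    (Metric.ball e₁ (δ / 2)) (Metric.ball_mem_nhds _ (by positivity))
  have hW := eventually_eventually_nhds.2 (eventually_abs_sub_lt_of_computes hM he₂A hε0)
  -- In that ball, whenever the point is close to the one of `e₂`, so is the sum.
  have hclose : ∀ e ∈ Metric.ball e₁ δ,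
      (∀ᶠ y in 𝓝 e.1.1, y ∈ A → |generalizedBrjuno G u ν s y - generalizedBrjuno G u ν s e₂.1.1| < ε) →
      |∑' k, e.1.2 k - generalizedBrjuno G u ν s e₂.1.1| < 2 * ε := by
    intro e he hey
    obtain ⟨e', ⟨h1, h2⟩, h3⟩ := mem_closure_iff_nhds.1 (hcl he) _
      (inter_mem (hfst.tendsto e hey) (Metric.ball_mem_nhds e hε0))
    have h4 := h1 h3
    rw [generalizedBrjuno_eq (hasSum_of_mem_closure hG hu hν e'.2 (hA h3))] at h4
    have h5 : |∑' k, e'.1.2 k - ∑' k, e.1.2 k| < ε :=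
      ((abs_tsum_sub_le _ _).trans (le_max_right _ _)).trans_lt h2
    rw [abs_lt] at *
    constructor <;> linarith [h4.1, h4.2, h5.1, h5.2]
  -- A point `e₃` of the graph close to `e₂`, and its perturbation, contradict this.
  obtain ⟨e₃, ⟨h3ball, h3W⟩, n, h, hh, h3h, h3t⟩ := exists_mem_termGraph_of_mem_nhds e₂
    (inter_mem (Metric.isOpen_ball.mem_nhds he₂) (hfst.tendsto e₂ hW))
  have h3W' := eventually_eventually_nhds.2 h3W
  simp only [h3h] at h3W'
  obtain ⟨n', h', hh', ⟨h4V, h4W⟩, h4d, h4s⟩ := hh.exists_perturbation (ν := ν) (s := s) hG hu hν hs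
    hpI hp (half_pos hδ) (inter_mem (Metric.ball_mem_nhds (h p) (half_pos hδ)) h3W')
  obtain ⟨a, ha⟩ := hh'.exists_mem_termGraph (ν := ν) (s := s) hG hu hν hs hpI hp
  have hat := apply_eq_brjunoTerm_of_mem_closure hG hu hν (subset_closure ha)
    (hh'.mem_invariantSet hG hpI hp)
  have h43 : dist (⟨(h' p, a), subset_closure ha⟩ : closure (termGraph G u ℓ r ν s p)) e₃ ≤ δ / 2 := by
    refine max_le ?_ ?_
    · change dist (h' p) e₃.1.1 ≤ _
      rw [h3h]
      exact (Metric.mem_ball.1 h4V).le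
    · change dist a e₃.1.2 ≤ _
      rw [dist_eq_norm, norm_lp_one]
      refine le_trans (le_of_eq (tsum_congr fun k => ?_)) h4d
      rw [← hat k, ← h3t k]
      rfl
  have h3lt : dist e₃ e₁ < δ / 2 := h3ball
  have c3 := hclose e₃ (h3lt.trans (by linarith)) h3W
  have c4 := hclose ⟨(h' p, a), subset_closure ha⟩
    ((dist_triangle _ e₃ _).trans_lt (by linarith)) h4W
  rw [tsum_congr h3t] at c3
  rw [tsum_congr hat] at c4
  have := abs_sub_le (∑' k, brjunoTerm G u ν s (h' p) k) (generalizedBrjuno G u ν s e₂.1.1)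
    (∑' k, brjunoTerm G u ν s (h p) k)
  rw [abs_sub_comm (generalizedBrjuno G u ν s e₂.1.1)] at this
  linarith

end

theorem theorem5p2 (G u : ℝ → ℝ) (ℓ r : ℕ → ℝ) (ν : ℝ) (s : ℕ → ℝ)
    (hG : IsExpandingBranchedMap G ℓ r)
    (hu : IsBrjunoWeight u (leftEnd ℓ r) (rightEnd ℓ r))
    (hν : 0 < ν)
    (hs : ∀ k, s k = 1 ∨ s k = -1) :
    ∃ x ∈ invariantSet G ℓ r,
      Tendsto (brjunoPartialSum G u ν s x) atTop (𝓝 (generalizedBrjuno G u ν s x)) ∧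
      ¬ IsComputableAt (generalizedBrjuno G u ν s) x := by
  obtain ⟨p, hpI, hp⟩ := hG.exists_fixedPoint
  by_contra! hcon
  set X := closure (termGraph G u ℓ r ν s p)
  have hXc : IsClosed X := isClosed_closure
  have : CompleteSpace X := hXc.completeSpace_coe
  obtain ⟨a₀, ha₀⟩ := (IsInverseIterate.id (G := G) (ℓ := ℓ) (r := r)).exists_mem_termGraph
    (ν := ν) (s := s) hG hu hν hs hpI hp
  have : Nonempty X := ⟨⟨_, subset_closure ha₀⟩⟩
  have hfst : Continuous fun e : X => e.1.1 := continuous_fst.comp continuous_subtype_val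
  set A : OracleProgram → Set ℝ := fun M => {x | x ∈ invariantSet G ℓ r ∧
    ∀ φ : ℕ → ℕ, IsOracleFor φ x → ∀ n : ℕ, ∃ d ∈ M.run φ n,
      |generalizedBrjuno G u ν s x - dyadic d| < (2 : ℝ) ^ (-(n : ℤ))}
  set C : OracleProgram ⊕ ℕ → Set X := Sum.elim (fun M => closure {e : X | e.1.1 ∈ A M})
    (fun n => {e : X | e.1.1 ∈ iterateDomain G ℓ r n}ᶜ)
  have hclosed : ∀ i, IsClosed (C i) := by
    rintro (M | n)
    · exact isClosed_closure
    · exact ((hG.isOpen_iterateDomain n).preimage hfst).isClosed_compl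
  have hcover : ⋃ i, C i = univ := by
    refine eq_univ_of_forall fun e => mem_iUnion.2 ?_
    by_cases hx : e.1.1 ∈ invariantSet G ℓ r
    · have hsum := hasSum_of_mem_closure hG hu hν e.2 hx
      obtain ⟨M, hM⟩ := hcon e.1.1 hx
        (by rw [generalizedBrjuno_eq hsum]; exact tendsto_brjunoPartialSum hsum)
      exact ⟨.inl M, subset_closure ⟨hx, hM _ rfl⟩⟩
    · simp only [invariantSet, mem_ofPred_eq, not_forall] at hx
      obtain ⟨j, hj⟩ := hx
      exact ⟨.inr (j + 1), fun h => hj (h j j.lt_succ_self)⟩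
  obtain ⟨i, e, he⟩ := nonempty_interior_of_iUnion_of_closed hclosed hcover
  rcases i with M | n
  · exact (interior_closure_computes_eq_empty hG hu hν hs hpI hp (fun x hx => hx.1)
      (fun x hx => hx.2)).subset he
  · obtain ⟨e', he', n', h, hh, h1, -⟩ :=
      exists_mem_termGraph_of_mem_nhds e (isOpen_interior.mem_nhds he)
    refine interior_subset he' ?_
    rw [mem_ofPred_eq, h1]
    exact invariantSet_subset_iterateDomain n (hh.mem_invariantSet hG hpI hp)
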